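/- **Setting.** Let $\mathbb{N}=\{1,2,3,\dots\}$, let $S_{\mathbb{N}}$ be the group of all permutations of $\mathbb{N}$, and let $S_\infty=\bigcup_n S_n\subseteq S_{\mathbb{N}}$, where $S_n$ is the subgroup fixing every $m>n$. Both groups act on the power series ring $\mathbb{Q}[[\mathbf{x}_\infty]]=\mathbb{Q}[[x_1,x_2,\dots]]$ by permuting the variables, and $e_r\in\mathbb{Q}[[\mathbf{x}_\infty]]$ is the $r$-th elementary symmetric function ($e_0=1$). An *infinite Ferrers diagram* $\hat\lambda\vdash\infty$ is a Ferrers diagram with infinite first row and only finitely many boxes below it; these boxes form its *finite part*. $\mathrm{SYT}(\hat\lambda)$ is the set of fillings $\hat T$ of $\hat\lambda$ by the elements of $\mathbb{N}$, each used exactly once, that increase along rows and down columns. An element $\hat M\in\mathrm{SSYT}(\hat\lambda)$ consists of a semi-standard filling (rows weakly and columns strictly increasing) of the finite part by positive integers, and of multiplicities $m_h\ge 0$ for $h>0$, of which finitely many are non-zero (the first row is viewed as infinitely many zeros, followed by $m_h$ copies of each $h>0$). An *infinite cocharge tableau* $\hat C\in\mathrm{CCT}(\hat\lambda)$ is an element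 of $\mathrm{SSYT}(\hat\lambda)$ such that every $h$ with $m_h>0$ shows up in the finite part, and such that for every $h>1$ showing up in the finite part, either its leftmost instance there lies in a row below an instance of $h-1$ in the finite part, or $m_{h-1}>0$. The *content* of $\hat M$ is the multi-set of its positive entries, including $m_h$ copies of each $h$ from the first row. If $k-1$ is its maximal element ($k=1$ if the content is empty), then $\mathrm{Dsp}^c(\hat M)$ is the multi-set $\{i_1,\dots,i_{k-1}\}$, where $i_g$ is the number of entries of the content that are at least $k-g$. Given $\hat T\in\mathrm{SYT}(\hat\lambda)$, let $R(\hat T)$ and $C(\hat T)$ be the subgroups of $S_{\mathbb{N}}$ that preserve every row, respectively every column, of $\hat T$ (the latter is finite). Let $p_{\hat M,\hat T}=\prod_i x_i^{h_i}$, where $h_i$ is the entry of $\hat M$ in the box that contains $i$ in $\hat T$ if this box is in the finite part, and where each $h>0$ equals $h_i$ for exactly $m_h$ of the numbers $i$ in the first row of $\hat T$ (all choices of $p_{\hat M,\hat T}$ lie in one $R(\hat T)$-orbit). The *stable generalized higher Specht polynomial* is $$F_{\hat M,\hat T}=\sum_{\sigma\in C(\hat T)}\mathrm{sgn}(\sigma)\,\sigma\Big(\sum_{p}p\Big),$$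 where $p$ runs over the distinct monomials in the $R(\hat T)$-orbit of $p_{\hat M,\hat T}$. Let $V_{\hat M}\subseteq\mathbb{Q}[[\mathbf{x}_\infty]]$ be the span of all the $F_{\hat M,\hat T}$ with $\hat T\in\mathrm{SYT}(\hat\lambda)$. For $\hat C\in\mathrm{CCT}(\hat\lambda)$ and a vector $\vec h=(h_r)_{r\ge1}$ of non-negative integers with finitely many non-zero entries, set $V_{\hat C}^{\vec h}=V_{\hat C}\cdot\prod_r e_r^{h_r}$. If a finite multi-set $I$ of non-negative integers contains $\mathrm{Dsp}^c(\hat C)$, let $A=I\setminus\mathrm{Dsp}^c(\hat C)$ (multi-set complement), let $\vec h(\hat C,I)$ be the vector whose $r$-th entry ($r\ge1$) is the multiplicity of $r$ in $A$, and set $F^{I,\mathrm{hom}}_{\hat C,\hat T}=F_{\hat C,\hat T}\prod_{i\in A}e_i$. If moreover $I$ is a set of positive integers, set $r_i=|\{j\in\mathbb{N}\setminus I: j<i\}|$ for $i\in I$, let $\vec h^I_{\hat C}$ be the vector with entries $h_r=|\{i\in A: r_i=r\}|$, $r\ge1$, and set $F^I_{\hat C,\hat T}=F_{\hat C,\hat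 T}\prod_{i\in A}e_{r_i}$. **Theorem.** Let $\hat\lambda\vdash\infty$, $\hat M\in\mathrm{SSYT}(\hat\lambda)$ and $\hat C\in\mathrm{CCT}(\hat\lambda)$, and let $\vec h$ be a vector as above. 1. The $F_{\hat M,\hat T}$, indexed by $\hat T\in\mathrm{SYT}(\hat\lambda)$, form a basis of $V_{\hat M}$ over $\mathbb{Q}$, and the products $F_{\hat C,\hat T}\prod_r e_r^{h_r}$ form a basis of $V_{\hat C}^{\vec h}$. In particular, the $F^I_{\hat C,\hat T}$ form a basis of $V_{\hat C}^{\vec h^I_{\hat C}}$ for every finite set $I$ of positive integers containing $\mathrm{Dsp}^c(\hat C)$, and the $F^{I,\mathrm{hom}}_{\hat C,\hat T}$ form a basis of $V_{\hat C}^{\vec h(\hat C,I)}$ for every finite multi-set $I$ of non-negative integers containing $\mathrm{Dsp}^c(\hat C)$. 2. $V_{\hat M}$ and $V_{\hat C}^{\vec h}$ are stable under $S_{\mathbb{N}}$ and under $S_\infty$, hence are representations of both groups. 3. For either group, the isomorphism type of these representations depends only on $\hat\lambda$: any two of the spaces $V_{\hat M}$, $V_{\hat C}^{\vec h}$ that arise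 from the same $\hat\lambda$ are isomorphic. 4. These representations are irreducible, for either group. 5. For either group, representations of this form that arise from different infinite Ferrers diagrams are not isomorphic. -/

import Mathlib

/-! Variables, and entries of standard tableaux, are labelled by `ℕ = {0, 1, 2, …}`: the label `i`
stands for the positive integer `i + 1`. Rows and columns are also counted from `0`, so that row `0`
is the first row. Integers that are not labels (the entries of semi-standard tableaux, the
indices `r` of the elementary symmetric functions `e_r`, the elements of the multi-sets `I`)
are not shifted. -/

namespace StableSpecht

open Equiv

/-- The ring `ℚ⟦x_∞⟧` of power series in countably many variables. -/
abbrev PS : Type := MvPowerSeries ℕ ℚ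

/-! ### The two infinite symmetric groups and their action -/

/-- The action of `S_ℕ = Perm ℕ` on `ℚ⟦x_∞⟧` by permuting the variables: `σ x_i = x_{σ i}`. -/
noncomputable def permRep : Representation ℚ (Perm ℕ) PS where
  toFun σ := (MvPowerSeries.renameEquiv ℚ σ).toLinearMap
  map_one' := by
    ext1 f
    exact MvPowerSeries.rename_id_apply f
  map_mul' σ τ := by
    ext1 f
    exact (MvPowerSeries.rename_rename (f := τ) (g := σ) f).symm

/-- `S_∞`, the union over `n` of the subgroups `S_n` of `S_ℕ` that fix every label
outside of the first `n` ones. -/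
def finPerm : Subgroup (Perm ℕ) where
  carrier := {σ | ∃ n : ℕ, ∀ m, n ≤ m → σ m = m}
  one_mem' := ⟨0, fun _ _ => rfl⟩
  mul_mem' := by
    rintro σ τ ⟨a, ha⟩ ⟨b, hb⟩
    refine ⟨max a b, fun m hm => ?_⟩
    rw [Perm.mul_apply, hb m (le_trans (le_max_right a b) hm),
      ha m (le_trans (le_max_left a b) hm)]
  inv_mem' := by
    rintro σ ⟨a, ha⟩
    exact ⟨a, fun m hm => Perm.inv_eq_iff_eq.mpr (ha m hm).symm⟩

/-- The restriction of the action on `ℚ⟦x_∞⟧` to `S_∞`. -/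
noncomputable def finPermRep : Representation ℚ finPerm PS := permRep.comp finPerm.subtype

open scoped Classical in
/-- The sign of a permutation with finite support: the usual sign of the permutation that it
induces on its support. (The value at other permutations is irrelevant.) -/
noncomputable def finSign (σ : Perm ℕ) : ℤˣ :=
  if h : {i | σ i ≠ i}.Finite then
    haveI : Fintype {i // σ i ≠ i} := h.fintype
    Perm.sign (σ.subtypePerm (p := fun i => σ i ≠ i) (fun i => by simp))
  else 1

/-! ### Infinite Ferrers diagrams and tableaux -/

/-- An infinite Ferrers diagram: a set of boxes `(row, column)` that is closed under moving up and
to the left, contains the whole first row, and has only finitely many boxes below it. -/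
@[ext]
structure InfDiagram where
  cells : Set (ℕ × ℕ)
  isLowerSet : IsLowerSet cells
  firstRow : ∀ j, (0, j) ∈ cells
  finite_lower : {c | c ∈ cells ∧ c.1 ≠ 0}.Finite

/-- The finite part of an infinite Ferrers diagram: all boxes that are not in the first row. -/
def InfDiagram.finPart (lam : InfDiagram) : Set (ℕ × ℕ) := {c | c ∈ lam.cells ∧ c.1 ≠ 0}

noncomputable instance (lam : InfDiagram) : Fintype lam.finPart := lam.finite_lower.fintype

/-- Infinite standard Young tableaux of shape `lam`, through the bijection that takes a label `i` to
the box `v_T(i)` containing it. Entries increase strictly along rows and columns. -/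
structure InfSYT (lam : InfDiagram) where
  box : ℕ ≃ lam.cells
  row_lt : ∀ i j, (box i).1.1 = (box j).1.1 → (box i).1.2 < (box j).1.2 → i < j
  col_lt : ∀ i j, (box i).1.2 = (box j).1.2 → (box i).1.1 < (box j).1.1 → i < j

/-- The row of the label `i` in `T`. -/
def InfSYT.row {lam : InfDiagram} (T : InfSYT lam) (i : ℕ) : ℕ := (T.box i).1.1

/-- The column of the label `i` in `T`. -/
def InfSYT.col {lam : InfDiagram} (T : InfSYT lam) (i : ℕ) : ℕ := (T.box i).1.2

/-- Infinite semi-standard Young tableaux of shape `lam`: a semi-standard filling of the finite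
part by positive integers, together with a finitely supported multiplicity for each `h > 0`
(the number of entries `h` in the first row, where they come after infinitely many zeros). -/
structure InfSSYT (lam : InfDiagram) where
  filling : lam.finPart → ℕ
  pos : ∀ c, 0 < filling c
  row_le : ∀ c c' : lam.finPart, c.1.1 = c'.1.1 → c.1.2 < c'.1.2 → filling c ≤ filling c'
  col_lt : ∀ c c' : lam.finPart, c.1.2 = c'.1.2 → c.1.1 < c'.1.1 → filling c < filling c'
  mult : ℕ →₀ ℕ
  mult_zero : mult 0 = 0

/-- Infinite cocharge tableaux: every `h > 0` with a positive multiplicity shows up in the finite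
part, and for every `h > 0` in the finite part, either its leftmost instance lies in a row
below an instance of `h - 1`, or `h - 1` has a positive multiplicity. For `h = 1` the second
condition is automatic, since `0` shows up infinitely often in the first row. -/
def InfSSYT.IsCocharge {lam : InfDiagram} (M : InfSSYT lam) : Prop :=
  (∀ h, 0 < M.mult h → ∃ c, M.filling c = h) ∧
  ∀ c, 1 < M.filling c → (∀ c', M.filling c' = M.filling c → c.1.2 ≤ c'.1.2) →
    (∃ c', M.filling c' = M.filling c - 1 ∧ c'.1.1 < c.1.1) ∨ 0 < M.mult (M.filling c - 1)

/-- The content of `M`, as a multi-set of positive integers. -/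
noncomputable def InfSSYT.content {lam : InfDiagram} (M : InfSSYT lam) : Multiset ℕ :=
  Finset.univ.val.map M.filling + Finsupp.toMultiset M.mult

/-- The multi-set `Dsp^c(M)`: if `k - 1` is the maximal entry of the content of `M` (with `k = 1` if
the content is empty), it consists of the numbers `i_g`, `1 ≤ g < k`, where `i_g` is
the number of entries of the content that are at least `k - g`. -/
noncomputable def InfSSYT.dspc {lam : InfDiagram} (M : InfSSYT lam) : Multiset ℕ :=
  let k := M.content.sup + 1
  (Finset.Ico 1 k).val.map fun g => M.content.countP fun x => k - g ≤ x

/-! ### Stable generalized higher Specht polynomials -/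

section Specht

variable {lam : InfDiagram}

/-- The group `R(T)` of the permutations preserving the rows of `T`. -/
def InfSYT.rowGroup (T : InfSYT lam) : Subgroup (Perm ℕ) where
  carrier := {σ | ∀ i, T.row (σ i) = T.row i}
  one_mem' := fun _ => rfl
  mul_mem' := fun {σ τ} hσ hτ i => (hσ (τ i)).trans (hτ i)
  inv_mem' := fun {σ} hσ i => by
    have h := hσ (σ⁻¹ i)
    simpa using h.symm

/-- The group `C(T)` of the permutations preserving the columns of `T`. -/
def InfSYT.colGroup (T : InfSYT lam) : Subgroup (Perm ℕ) where
  carrier := {σ | ∀ i, T.col (σ i) = T.col i}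
  one_mem' := fun _ => rfl
  mul_mem' := fun {σ τ} hσ hτ i => (hσ (τ i)).trans (hτ i)
  inv_mem' := fun {σ} hσ i => by
    have h := hσ (σ⁻¹ i)
    simpa using h.symm

/-- Only finitely many labels lie in a column with more than one box. -/
theorem InfSYT.finite_long (T : InfSYT lam) : {i | (1, T.col i) ∈ lam.cells}.Finite := by
  have hcols : {j | (1, j) ∈ lam.cells}.Finite := by
    refine (lam.finite_lower.image Prod.snd).subset fun j hj => ⟨(1, j), ⟨hj, by simp⟩, rfl⟩
  have hcells : {c : lam.cells | (1, c.1.2) ∈ lam.cells}.Finite := by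
    refine Set.Finite.of_finite_image (f := Subtype.val) ?_ Subtype.val_injective.injOn
    refine ((hcols.image fun j => (0, j)).union lam.finite_lower).subset ?_
    rintro _ ⟨⟨⟨a, b⟩, hc⟩, hb, rfl⟩
    rcases Nat.eq_zero_or_pos a with rfl | ha
    · exact Or.inl ⟨b, hb, rfl⟩
    · exact Or.inr ⟨hc, ha.ne'⟩
  exact hcells.preimage (f := T.box) T.box.injective.injOn

/-- The column group fixes every label that is alone in its column. -/
theorem InfSYT.colGroup_fix (T : InfSYT lam) {σ : Perm ℕ} (hσ : σ ∈ T.colGroup) {i : ℕ}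
    (hi : (1, T.col i) ∉ lam.cells) : σ i = i := by
  have key : ∀ j, T.col j = T.col i → (T.box j).1.1 = 0 := by
    intro j hj
    by_contra h
    refine hi (lam.isLowerSet (a := (T.box j).1) ⟨Nat.one_le_iff_ne_zero.mpr h, ?_⟩ (T.box j).2)
    exact le_of_eq hj.symm
  apply T.box.injective
  apply Subtype.ext
  exact Prod.ext ((key _ (hσ i)).trans (key i rfl).symm) (hσ i)

instance (T : InfSYT lam) : Finite T.colGroup := by
  have := T.finite_long.to_subtype
  let N : Set ℕ := {i | (1, T.col i) ∈ lam.cells}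
  let φ : T.colGroup → (N → N) := fun σ i =>
    ⟨σ.1 i.1, by
      change (1, T.col (σ.1 i.1)) ∈ lam.cells
      rw [σ.2 i.1]
      exact i.2⟩
  refine Finite.of_injective φ fun σ τ h => ?_
  apply Subtype.ext
  ext i
  by_cases hi : i ∈ N
  · exact congrArg Subtype.val (congrFun h ⟨i, hi⟩)
  · rw [T.colGroup_fix σ.2 hi, T.colGroup_fix τ.2 hi]

noncomputable instance (T : InfSYT lam) : Fintype T.colGroup := Fintype.ofFinite _

/-- `p` is the exponent of one of the possible monomials `p_{M,T}`: the exponent of `x_i` is the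
entry of `M` in the box of `i` if that box is in the finite part, and each `h > 0` is the
exponent of `x_i` for exactly `mult h` of the labels `i` in the first row of `T`. -/
def IsLeadingExponent (M : InfSSYT lam) (T : InfSYT lam) (p : ℕ →₀ ℕ) : Prop :=
  (∀ i, ∀ h : (T.box i).1.1 ≠ 0, p i = M.filling ⟨(T.box i).1, (T.box i).2, h⟩) ∧
  ∀ h, 0 < h → {i | T.row i = 0 ∧ p i = h}.ncard = M.mult h

open scoped Classical in
/-- The sum of all the different monomials in the `R(T)`-orbit of `p_{M,T}`. All the possible
choices of `p_{M,T}` lie in a single orbit, so this does not depend on that choice. -/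
noncomputable def rowOrbitSum (M : InfSSYT lam) (T : InfSYT lam) : PS := fun d =>
  if ∃ p, IsLeadingExponent M T p ∧ ∃ τ ∈ T.rowGroup, d = p.mapDomain τ then 1 else 0

/-- The stable generalized higher Specht polynomial `F_{M,T}`. -/
noncomputable def F (M : InfSSYT lam) (T : InfSYT lam) : PS :=
  ∑ σ : T.colGroup, ((finSign σ.1 : ℤ) : ℚ) • permRep σ.1 (rowOrbitSum M T)

open scoped Classical in
/-- The elementary symmetric function `e_r`: the sum of all squarefree monomials of degree `r`. -/
noncomputable def esymm (r : ℕ) : PS := fun d =>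
  if (∀ i, d i ≤ 1) ∧ d.degree = r then 1 else 0

/-- The product `∏_r e_r ^ h_r`. As `e_0 = 1`, the value of `h` at `0` plays no role. -/
noncomputable def esymmProd (h : ℕ →₀ ℕ) : PS := h.prod fun r k => esymm r ^ k

/-- The space `V_M` spanned by all the `F_{M,T}`, with `T` standard. -/
noncomputable def V (M : InfSSYT lam) : Submodule ℚ PS :=
  Submodule.span ℚ (Set.range fun T : InfSYT lam => F M T)

/-- The space `V_C^h` of the products of elements of `V_C` with `∏_r e_r ^ h_r`. -/
noncomputable def Vh (C : InfSSYT lam) (h : ℕ →₀ ℕ) : Submodule ℚ PS :=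
  (V C).map (LinearMap.mulRight ℚ (esymmProd h))

/-- For a set `I` of positive integers, `r_i` is the number of positive integers `j < i` that are
not in `I`. -/
def rIndex (I : Finset ℕ) (i : ℕ) : ℕ := ((Finset.Ico 1 i).filter fun j => j ∉ I).card

/-- The complement `Asp^c_I(C)` of `Dsp^c(C)` in the multi-set `I`. -/
noncomputable def aspc (C : InfSSYT lam) (I : Multiset ℕ) : Multiset ℕ := I - C.dspc

/-- The vector of the numbers `h_r = |{i ∈ Asp^c_I(C) | r_i = r}|`, `r > 0`. -/
noncomputable def hSet (C : InfSSYT lam) (I : Finset ℕ) : ℕ →₀ ℕ :=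
  (Multiset.toFinsupp ((aspc C I.val).map (rIndex I))).erase 0

/-- The characteristic vector of `Asp^c_I(C)`, with the multiplicity of `0` omitted. -/
noncomputable def hMultiset (C : InfSSYT lam) (I : Multiset ℕ) : ℕ →₀ ℕ :=
  (Multiset.toFinsupp (aspc C I)).erase 0

/-- `F_{C,T}^I`, for a set `I`. -/
noncomputable def FSet (C : InfSSYT lam) (I : Finset ℕ) (T : InfSYT lam) : PS :=
  F C T * ((aspc C I.val).map fun i => esymm (rIndex I i)).prod

/-- `F_{C,T}^{I,hom}`, for a multi-set `I`. -/
noncomputable def FHom (C : InfSSYT lam) (I : Multiset ℕ) (T : InfSYT lam) : PS :=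
  F C T * ((aspc C I).map esymm).prod

end Specht

/-- `U` is one of the spaces attached to the diagram `lam`: either `V_M` for a semi-standard
`M`, or `V_C^h` for a cocharge tableau `C` and a vector `h`. -/
def IsSpechtSpace (lam : InfDiagram) (U : Submodule ℚ PS) : Prop :=
  (∃ M : InfSSYT lam, U = V M) ∨
  ∃ (C : InfSSYT lam) (h : ℕ →₀ ℕ), C.IsCocharge ∧ U = Vh C h

end StableSpecht

namespace StableSpecht

open Equiv

variable {lam lam' : InfDiagram}

/-! ### Signs of finitely supported permutations -/

/-! All the spaces attached to $\hat\lambda$ are equivariant copies of one Specht module, so the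
theorem reduces to James's theory of polytabloids, carried over to an infinite first row. A tabloid
is the function taking a label to its row. In the free module on all functions, which serves every
diagram at once, the Specht module is spanned by the polytabloids $e_T=\sum_{\sigma\in
C(T)}\mathrm{sgn}(\sigma)\,\sigma\{T\}$. Only finitely many columns have more than one box. Hence
$C(T)$ is finite, $e_T$ depends only on the labels in those columns, and $S_\infty$ already permutes
the polytabloids of a given shape transitively. This is why both groups behave alike.

Three facts about Specht modules are needed. The standard polytabloids form a basis: each has its
own tabloid as colexicographically largest term (`linearIndependent_polytabloid`), and Garnir
relations express every other polytabloid through them (`polytabloid_mem_span_standard`). The module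
is irreducible over $S_\infty$ (`eq_bot_or_eq_spechtModule`): the antisymmetrizer of $C(T)$ maps it
into the line of $e_T$, and a vector killed by all of these is orthogonal to itself, hence zero. The
module determines the diagram (`diagram_eq_of_equiv`): comparing the finite sums of row indices
forces the tabloids of the two shapes to agree up to a permutation.

Sending a tabloid to its orbit sum of monomials gives the equivariant map `toSeries`, with
$e_T\mapsto F_{\hat M,\hat T}$. It is injective on the Specht module: by irreducibility it suffices
that $e_T$ is not killed, and a leading monomial whose exponents increase down the columns has
coefficient $1$ in its image. Multiplication by $\prod_r e_r^{h_r}$ is injective and equivariant,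
since the power series ring is a domain and the $e_r$ are invariant. `IsSpechtMap` packages such an
identification, and all five statements are transported along it. -/

theorem mem_finPerm_iff {σ : Perm ℕ} : σ ∈ finPerm ↔ {i | σ i ≠ i}.Finite := by
  constructor
  · rintro ⟨n, hn⟩
    refine (Set.finite_lt_nat n).subset fun i hi => ?_
    by_contra h
    exact hi (hn i (not_lt.mp h))
  · intro h
    obtain ⟨n, hn⟩ := h.bddAbove
    refine ⟨n + 1, fun m hm => ?_⟩
    by_contra hne
    have := hn hne
    omega

/-- The support varies with the permutation; computing signs on a common finite set that contains
the supports reduces multiplicativity to that of `Perm.sign`. -/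
theorem finSign_eq_sign_subtypePerm {σ : Perm ℕ} (s : Finset ℕ) (hs : ∀ i, σ i ≠ i → i ∈ s)
    (h : ∀ i, σ i ∈ s ↔ i ∈ s) : finSign σ = Perm.sign (σ.subtypePerm (p := (· ∈ s)) h) := by
  classical
  have hf : {i | σ i ≠ i}.Finite := s.finite_toSet.subset fun i hi => hs i hi
  have hf' : Fintype {i // σ i ≠ i} := hf.fintype
  rw [finSign, dif_pos hf]
  have h1 := Perm.sign_subtypePerm (σ.subtypePerm (p := (· ∈ s)) h)
    (p := fun x => σ x.1 ≠ x.1) (fun x => by simp) (fun x hx => by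
      intro h2
      exact hx (Subtype.ext h2))
  rw [← h1]
  symm
  let e : {x : {i // i ∈ s} // σ x.1 ≠ x.1} ≃ {i // σ i ≠ i} :=
    { toFun := fun x => ⟨x.1.1, x.2⟩
      invFun := fun x => ⟨⟨x.1, hs _ x.2⟩, x.2⟩
      left_inv := fun _ => rfl
      right_inv := fun _ => rfl }
  rw [← Perm.sign_permCongr e]
  congr!

theorem mem_iff_of_moved_mem {σ : Perm ℕ} {s : Finset ℕ} (hs : ∀ i, σ i ≠ i → i ∈ s) (i : ℕ) :
    σ i ∈ s ↔ i ∈ s := by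
  by_cases h : σ i = i
  · rw [h]
  · exact iff_of_true (hs _ fun h' => h (σ.injective h')) (hs _ h)

theorem finSign_mul {σ τ : Perm ℕ} (hσ : σ ∈ finPerm) (hτ : τ ∈ finPerm) :
    finSign (σ * τ) = finSign σ * finSign τ := by
  classical
  rw [mem_finPerm_iff] at hσ hτ
  let s : Finset ℕ := hσ.toFinset ∪ hτ.toFinset
  have h1 : ∀ i, σ i ≠ i → i ∈ s := fun i hi => by simp [s, hi]
  have h2 : ∀ i, τ i ≠ i → i ∈ s := fun i hi => by simp [s, hi]
  have h3 : ∀ i, (σ * τ) i ≠ i → i ∈ s := fun i hi => by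
    by_contra hn
    have a : τ i = i := by_contra fun h => hn (h2 i h)
    have b : σ i = i := by_contra fun h => hn (h1 i h)
    exact hi (by rw [Perm.mul_apply, a, b])
  rw [finSign_eq_sign_subtypePerm s h1 (mem_iff_of_moved_mem h1),
    finSign_eq_sign_subtypePerm s h2 (mem_iff_of_moved_mem h2),
    finSign_eq_sign_subtypePerm s h3 (mem_iff_of_moved_mem h3), ← Perm.sign_mul]
  congr 1

theorem finSign_one : finSign 1 = 1 := by
  have h := finSign_mul finPerm.one_mem finPerm.one_mem
  rw [mul_one] at h
  exact (mul_eq_left.mp h.symm)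

theorem swap_mem_finPerm (a b : ℕ) : swap a b ∈ finPerm := by
  rw [mem_finPerm_iff]
  refine (Set.toFinite {a, b}).subset fun i hi => ?_
  by_contra h
  simp only [Set.mem_insert_iff, Set.mem_singleton_iff, not_or] at h
  exact hi (swap_apply_of_ne_of_ne h.1 h.2)

theorem finSign_swap {a b : ℕ} (hab : a ≠ b) : finSign (swap a b) = -1 := by
  classical
  have h1 : ∀ i, swap a b i ≠ i → i ∈ ({a, b} : Finset ℕ) := fun i hi => by
    by_contra h
    simp only [Finset.mem_insert, Finset.mem_singleton, not_or] at h
    exact hi (swap_apply_of_ne_of_ne h.1 h.2)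
  rw [finSign_eq_sign_subtypePerm {a, b} h1 (mem_iff_of_moved_mem h1)]
  have : (swap a b).subtypePerm (p := (· ∈ ({a, b} : Finset ℕ))) (mem_iff_of_moved_mem h1) =
      swap ⟨a, by simp⟩ ⟨b, by simp⟩ := by
    ext ⟨x, hx⟩
    simp only [Perm.subtypePerm_apply, swap_apply_def, Subtype.mk.injEq]
    split_ifs <;> rfl
  rw [this, Perm.sign_swap (by simpa using hab)]

/-- A permutation agrees with a finitely supported one on any given finite set. -/
theorem exists_finPerm_eqOn (σ : Perm ℕ) (s : Finset ℕ) :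
    ∃ τ ∈ finPerm, ∀ i ∈ s, τ i = σ i := by
  classical
  induction s using Finset.induction_on with
  | empty => exact ⟨1, finPerm.one_mem, by simp⟩
  | insert a s ha ih =>
    obtain ⟨τ, hτ, h⟩ := ih
    refine ⟨swap (τ a) (σ a) * τ, finPerm.mul_mem (swap_mem_finPerm _ _) hτ, fun i hi => ?_⟩
    rcases Finset.mem_insert.mp hi with rfl | hi
    · simp
    · have hia : i ≠ a := fun h' => ha (h' ▸ hi)
      rw [Perm.mul_apply, swap_apply_of_ne_of_ne, h i hi]
      · exact fun h' => hia (τ.injective h')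
      · rw [h i hi]
        exact fun h' => hia (σ.injective h')

/-! ### The permutation module on functions of the labels -/

/-- The free module on the functions `ℕ → ℕ`. A function is thought of as a tabloid, assigning
to each label its row. -/
abbrev TabloidModule : Type := (ℕ → ℕ) →₀ ℚ

/-- The action of `S_ℕ` on `TabloidModule`. -/
noncomputable def tabloidRep : Representation ℚ (Perm ℕ) TabloidModule where
  toFun σ := Finsupp.lmapDomain ℚ ℚ fun t => t ∘ ⇑σ⁻¹
  map_one' := Finsupp.lmapDomain_id ℚ ℚ
  map_mul' σ τ := by
    ext t : 1
    ext1
    simp [Function.comp_assoc]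

@[simp]
theorem tabloidRep_single (σ : Perm ℕ) (t : ℕ → ℕ) (a : ℚ) :
    tabloidRep σ (Finsupp.single t a) = Finsupp.single (t ∘ ⇑σ⁻¹) a := by
  simp [tabloidRep]

theorem tabloidRep_apply (σ : Perm ℕ) (x : TabloidModule) (t : ℕ → ℕ) :
    tabloidRep σ x t = x (t ∘ ⇑σ) := by
  have hinj : Function.Injective fun t : ℕ → ℕ => t ∘ ⇑σ⁻¹ := fun s t h =>
    σ⁻¹.surjective.injective_comp_right h
  have : t = (fun t : ℕ → ℕ => t ∘ ⇑σ⁻¹) (t ∘ ⇑σ) := by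
    ext i
    simp
  conv_lhs => rw [this]
  exact Finsupp.mapDomain_apply hinj x _

/-- The antisymmetrizer of a finite group of permutations. -/
noncomputable def antisymm (H : Subgroup (Perm ℕ)) [Fintype H] :
    TabloidModule →ₗ[ℚ] TabloidModule :=
  ∑ σ : H, ((finSign σ.1 : ℤ) : ℚ) • tabloidRep σ.1

theorem antisymm_apply (H : Subgroup (Perm ℕ)) [Fintype H] (x : TabloidModule) :
    antisymm H x = ∑ σ : H, ((finSign σ.1 : ℤ) : ℚ) • tabloidRep σ.1 x := by
  simp [antisymm]

theorem finSign_mul_self (σ : Perm ℕ) : ((finSign σ : ℤ) : ℚ) * ((finSign σ : ℤ) : ℚ) = 1 := by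
  rcases Int.units_eq_one_or (finSign σ) with h | h <;> simp [h]

theorem antisymm_tabloidRep {H : Subgroup (Perm ℕ)} [Fintype H] (hH : H ≤ finPerm)
    {τ : Perm ℕ} (hτ : τ ∈ H) (x : TabloidModule) :
    antisymm H (tabloidRep τ x) = ((finSign τ : ℤ) : ℚ) • antisymm H x := by
  rw [antisymm_apply, antisymm_apply, Finset.smul_sum]
  refine Fintype.sum_equiv (Equiv.mulRight (⟨τ, hτ⟩ : H)) _ _ fun σ => ?_
  rw [Equiv.coe_mulRight, Subgroup.coe_mul, finSign_mul (hH σ.2) (hH hτ), smul_smul, map_mul,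
    Module.End.mul_apply]
  congr 1
  push_cast
  rw [mul_comm, mul_assoc, finSign_mul_self, mul_one]

theorem tabloidRep_antisymm {H : Subgroup (Perm ℕ)} [Fintype H] (hH : H ≤ finPerm)
    {τ : Perm ℕ} (hτ : τ ∈ H) (x : TabloidModule) :
    tabloidRep τ (antisymm H x) = ((finSign τ : ℤ) : ℚ) • antisymm H x := by
  rw [antisymm_apply, map_sum, Finset.smul_sum]
  refine Fintype.sum_equiv (Equiv.mulLeft (⟨τ, hτ⟩ : H)) _ _ fun σ => ?_
  rw [Equiv.coe_mulLeft, Subgroup.coe_mul, finSign_mul (hH hτ) (hH σ.2), smul_smul, map_mul,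
    Module.End.mul_apply, map_smul]
  congr 1
  push_cast
  rw [← mul_assoc, finSign_mul_self, one_mul]

/-- Absorbing the transposition, which fixes `x` but has sign $-1$, shows that the result equals its
own negative. -/
theorem antisymm_eq_zero {H : Subgroup (Perm ℕ)} [Fintype H] (hH : H ≤ finPerm) {a b : ℕ}
    (hab : a ≠ b) (hs : swap a b ∈ H) {x : TabloidModule} (hx : tabloidRep (swap a b) x = x) :
    antisymm H x = 0 := by
  have h := antisymm_tabloidRep hH hs x
  rw [hx, finSign_swap hab] at h
  simp only [Units.val_neg, Units.val_one, Int.cast_neg, Int.cast_one, neg_smul, one_smul] at h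
  exact self_eq_neg.mp h

theorem comp_swap {t : ℕ → ℕ} {a b : ℕ} (h : t a = t b) : t ∘ ⇑(swap a b)⁻¹ = t := by
  ext i
  rw [swap_inv, Function.comp_apply, swap_apply_def]
  split_ifs with h1 h2
  · rw [h1, h]
  · rw [h2, h]
  · rfl

/-! ### Tableaux -/

/-- Tableaux of shape `lam`, with no monotonicity conditions. -/
abbrev Tableau (lam : InfDiagram) : Type := ℕ ≃ lam.cells

/-- The row of a label. -/
def rowOf (T : Tableau lam) (i : ℕ) : ℕ := (T i).1.1

/-- The column of a label. -/
def colOf (T : Tableau lam) (i : ℕ) : ℕ := (T i).1.2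

theorem label_ext (T : Tableau lam) {i j : ℕ} (hr : rowOf T i = rowOf T j)
    (hc : colOf T i = colOf T j) : i = j :=
  T.injective (Subtype.ext (Prod.ext hr hc))

/-- The column group of a tableau. -/
def columnGroup (T : Tableau lam) : Subgroup (Perm ℕ) where
  carrier := {σ | ∀ i, colOf T (σ i) = colOf T i}
  one_mem' := fun _ => rfl
  mul_mem' := fun {σ τ} hσ hτ i => (hσ (τ i)).trans (hτ i)
  inv_mem' := fun {σ} hσ i => by
    have h := hσ (σ⁻¹ i)
    simpa using h.symm

theorem swap_mem_columnGroup {T : Tableau lam} {a b : ℕ} (h : colOf T a = colOf T b) :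
    swap a b ∈ columnGroup T := by
  intro i
  rw [swap_apply_def]
  split_ifs with h1 h2
  · rw [h1, h]
  · rw [h2, h]
  · rfl

/-- A lower finite set of naturals is an initial segment. -/
theorem exists_mem_iff_lt {s : Set ℕ} (hs : IsLowerSet s) (hf : s.Finite) :
    ∃ n, ∀ j, j ∈ s ↔ j < n := by
  classical
  obtain ⟨b, hb⟩ := hf.bddAbove
  have hex : ∃ n, n ∉ s := ⟨b + 1, fun h => by have := hb h; omega⟩
  refine ⟨Nat.find hex, fun j => ⟨fun hj => ?_, fun hj => not_not.mp (Nat.find_min hex hj)⟩⟩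
  by_contra h
  exact Nat.find_spec hex (hs (not_lt.mp h) hj)

theorem InfDiagram.exists_width (lam : InfDiagram) : ∃ n, ∀ j, (1, j) ∈ lam.cells ↔ j < n := by
  refine exists_mem_iff_lt (s := {j | (1, j) ∈ lam.cells}) (fun a b hab ha => ?_) ?_
  · exact lam.isLowerSet (a := (1, a)) ⟨le_rfl, hab⟩ ha
  · exact (lam.finite_lower.image Prod.snd).subset fun j hj => ⟨(1, j), ⟨hj, by simp⟩, rfl⟩

theorem InfDiagram.exists_height (lam : InfDiagram) (j : ℕ) :
    ∃ n, ∀ r, (r, j) ∈ lam.cells ↔ r < n := by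
  refine exists_mem_iff_lt (s := {r | (r, j) ∈ lam.cells}) (fun a b hab ha => ?_) ?_
  · exact lam.isLowerSet (a := (a, j)) ⟨hab, le_rfl⟩ ha
  · refine ((lam.finite_lower.image Prod.fst).union (Set.finite_singleton 0)).subset fun r hr => ?_
    rcases eq_or_ne r 0 with rfl | h
    · exact Or.inr rfl
    · exact Or.inl ⟨(r, j), ⟨hr, h⟩, rfl⟩

/-- The number of columns with more than one box. -/
noncomputable def InfDiagram.width (lam : InfDiagram) : ℕ := lam.exists_width.choose

theorem InfDiagram.mem_one_iff {j : ℕ} : (1, j) ∈ lam.cells ↔ j < lam.width :=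
  lam.exists_width.choose_spec j

/-- The height of a column. -/
noncomputable def InfDiagram.height (lam : InfDiagram) (j : ℕ) : ℕ := (lam.exists_height j).choose

theorem InfDiagram.mem_cells_iff {r j : ℕ} : (r, j) ∈ lam.cells ↔ r < lam.height j :=
  (lam.exists_height j).choose_spec r

theorem rowOf_lt_height (T : Tableau lam) (i : ℕ) : rowOf T i < lam.height (colOf T i) :=
  InfDiagram.mem_cells_iff.mp (T i).2

theorem InfDiagram.height_anti {j k : ℕ} (h : j ≤ k) : lam.height k ≤ lam.height j := by
  by_contra hc
  have h1 : (lam.height j, k) ∈ lam.cells := InfDiagram.mem_cells_iff.mpr (not_le.mp hc)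
  have h2 : (lam.height j, j) ∈ lam.cells := lam.isLowerSet (a := (lam.height j, k)) ⟨le_rfl, h⟩ h1
  exact lt_irrefl _ (InfDiagram.mem_cells_iff.mp h2)

theorem row_eq_zero_of_width_le {c : ℕ × ℕ} (hc : c ∈ lam.cells) (h : lam.width ≤ c.2) :
    c.1 = 0 := by
  by_contra h0
  have : (1, c.2) ∈ lam.cells := lam.isLowerSet (a := c) ⟨Nat.one_le_iff_ne_zero.mpr h0, le_rfl⟩ hc
  exact absurd (InfDiagram.mem_one_iff.mp this) (not_lt.mpr h)

theorem colOf_lt_width (T : Tableau lam) {i : ℕ} (h : rowOf T i ≠ 0) : colOf T i < lam.width := by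
  by_contra hc
  exact h (row_eq_zero_of_width_le (T i).2 (not_lt.mp hc))

theorem finite_long_cells (lam : InfDiagram) : {c : lam.cells | c.1.2 < lam.width}.Finite := by
  refine Set.Finite.of_finite_image (f := Subtype.val) ?_ Subtype.val_injective.injOn
  refine (((Set.finite_lt_nat lam.width).image fun j => (0, j)).union lam.finite_lower).subset ?_
  rintro _ ⟨⟨⟨a, b⟩, hc⟩, hb, rfl⟩
  rcases Nat.eq_zero_or_pos a with rfl | ha
  · exact Or.inl ⟨b, hb, rfl⟩
  · exact Or.inr ⟨hc, ha.ne'⟩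

/-- The cells in the columns with more than one box. -/
noncomputable def longCells (lam : InfDiagram) : Finset lam.cells := (finite_long_cells lam).toFinset

theorem mem_longCells {c : lam.cells} : c ∈ longCells lam ↔ c.1.2 < lam.width := by
  simp [longCells]

/-- The labels in the columns with more than one box. -/
noncomputable def longLabels (T : Tableau lam) : Finset ℕ :=
  (longCells lam).map T.symm.toEmbedding

theorem mem_longLabels {T : Tableau lam} {i : ℕ} : i ∈ longLabels T ↔ colOf T i < lam.width := by
  simp only [longLabels, Finset.mem_map_equiv, mem_longCells, colOf, Equiv.symm_symm]

theorem rowOf_eq_zero {T : Tableau lam} {i : ℕ} (hi : i ∉ longLabels T) : rowOf T i = 0 := by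
  by_contra h
  exact hi (mem_longLabels.mpr (colOf_lt_width T h))

/-- Outside the long columns every label is in row `0`, so its column alone determines it. -/
theorem columnGroup_fix {T : Tableau lam} {σ : Perm ℕ} (hσ : σ ∈ columnGroup T) {i : ℕ}
    (hi : i ∉ longLabels T) : σ i = i := by
  refine label_ext T ?_ (hσ i)
  rw [rowOf_eq_zero hi, rowOf_eq_zero]
  rwa [mem_longLabels, hσ i, ← mem_longLabels]

theorem columnGroup_le_finPerm (T : Tableau lam) : columnGroup T ≤ finPerm := by
  intro σ hσ
  rw [mem_finPerm_iff]
  refine (longLabels T).finite_toSet.subset fun i hi => ?_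
  by_contra h
  exact hi (columnGroup_fix hσ h)

/-- A group of permutations that move only the elements of a given finite set is finite. -/
theorem finite_of_moved_mem {H : Subgroup (Perm ℕ)} (s : Finset ℕ)
    (h : ∀ σ ∈ H, ∀ i, i ∉ s → σ i = i) : Finite H := by
  let φ : H → (s → s) := fun σ i => ⟨σ.1 i.1,
    (mem_iff_of_moved_mem (fun i hi => by_contra fun hn => hi (h _ σ.2 i hn)) _).mpr i.2⟩
  refine Finite.of_injective φ fun σ τ hστ => ?_
  apply Subtype.ext
  ext i
  by_cases hi : i ∈ s
  · exact congrArg Subtype.val (congrFun hστ ⟨i, hi⟩)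
  · rw [h _ σ.2 i hi, h _ τ.2 i hi]

instance (T : Tableau lam) : Finite (columnGroup T) :=
  finite_of_moved_mem (longLabels T) fun _ hσ _ hi => columnGroup_fix hσ hi

noncomputable instance (T : Tableau lam) : Fintype (columnGroup T) := Fintype.ofFinite _

/-- The tableau `σ T`. -/
def relabel (σ : Perm ℕ) (T : Tableau lam) : Tableau lam := (σ⁻¹ : Perm ℕ).trans T

@[simp]
theorem relabel_apply (σ : Perm ℕ) (T : Tableau lam) (i : ℕ) : relabel σ T i = T (σ⁻¹ i) := rfl

@[simp]
theorem relabel_symm_apply (σ : Perm ℕ) (T : Tableau lam) (c : lam.cells) :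
    (relabel σ T).symm c = σ (T.symm c) := rfl

theorem rowOf_relabel (σ : Perm ℕ) (T : Tableau lam) : rowOf (relabel σ T) = rowOf T ∘ ⇑σ⁻¹ := rfl

theorem colOf_relabel (σ : Perm ℕ) (T : Tableau lam) : colOf (relabel σ T) = colOf T ∘ ⇑σ⁻¹ := rfl

theorem exists_relabel (T T' : Tableau lam) : ∃ σ, relabel σ T = T' := by
  refine ⟨T.trans T'.symm, ?_⟩
  ext i : 1
  change T (T.symm (T' i)) = T' i
  simp

/-- The polytabloid of a tableau. -/
noncomputable def polytabloid (T : Tableau lam) : TabloidModule :=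
  antisymm (columnGroup T) (Finsupp.single (rowOf T) 1)

theorem conj_mem_columnGroup {T : Tableau lam} {σ π : Perm ℕ} (hπ : π ∈ columnGroup T) :
    σ * π * σ⁻¹ ∈ columnGroup (relabel σ T) := by
  intro i
  have h := hπ (σ⁻¹ i)
  simpa [colOf_relabel] using h

/-- As `σ` may move infinitely many labels, `finSign_mul` does not apply; the signs are compared
along the bijection that `σ` induces from the support of `π` to its image. -/
theorem finSign_conj (σ : Perm ℕ) {π : Perm ℕ} (hπ : π ∈ finPerm) :
    finSign (σ * π * σ⁻¹) = finSign π := by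
  classical
  rw [mem_finPerm_iff] at hπ
  have h1 : ∀ i, π i ≠ i → i ∈ hπ.toFinset := fun i hi => by simpa using hi
  have h2 : ∀ i, (σ * π * σ⁻¹) i ≠ i → i ∈ hπ.toFinset.map σ.toEmbedding := fun i hi => by
    rw [Finset.mem_map_equiv]
    refine h1 _ fun h => hi ?_
    change π (σ⁻¹ i) = σ⁻¹ i at h
    rw [Perm.mul_apply, Perm.mul_apply, h]
    simp
  rw [finSign_eq_sign_subtypePerm _ h1 (mem_iff_of_moved_mem h1),
    finSign_eq_sign_subtypePerm _ h2 (mem_iff_of_moved_mem h2)]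
  let e : {i // i ∈ hπ.toFinset} ≃ {i // i ∈ hπ.toFinset.map σ.toEmbedding} :=
    σ.subtypeEquiv fun i => by simp
  rw [← Perm.sign_permCongr e]
  congr 1

theorem tabloidRep_polytabloid (σ : Perm ℕ) (T : Tableau lam) :
    tabloidRep σ (polytabloid T) = polytabloid (relabel σ T) := by
  rw [polytabloid, polytabloid, antisymm_apply, antisymm_apply, map_sum]
  let e : columnGroup T ≃ columnGroup (relabel σ T) :=
    { toFun := fun π => ⟨σ * π.1 * σ⁻¹, conj_mem_columnGroup π.2⟩
      invFun := fun π => ⟨σ⁻¹ * π.1 * σ, by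
        intro i
        have := π.2 (σ i)
        simpa [colOf_relabel] using this⟩
      left_inv := fun π => by
        apply Subtype.ext
        simp [mul_assoc]
      right_inv := fun π => by
        apply Subtype.ext
        simp [mul_assoc] }
  refine Fintype.sum_equiv e _ _ fun π => ?_
  change _ = ((finSign (σ * π.1 * σ⁻¹) : ℤ) : ℚ) • tabloidRep (σ * π.1 * σ⁻¹) _
  rw [finSign_conj σ (columnGroup_le_finPerm T π.2), map_smul]
  congr 1
  simp [rowOf_relabel, Function.comp_assoc, mul_assoc]

/-- The Specht module of an infinite Ferrers diagram. -/
noncomputable def spechtModule (lam : InfDiagram) : Submodule ℚ TabloidModule :=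
  Submodule.span ℚ (Set.range fun T : Tableau lam => polytabloid T)

theorem polytabloid_mem (T : Tableau lam) : polytabloid T ∈ spechtModule lam :=
  Submodule.subset_span ⟨T, rfl⟩

theorem tabloidRep_mem {x : TabloidModule} (hx : x ∈ spechtModule lam) (σ : Perm ℕ) :
    tabloidRep σ x ∈ spechtModule lam := by
  induction hx using Submodule.span_induction with
  | mem x hx =>
    obtain ⟨T, rfl⟩ := hx
    change tabloidRep σ (polytabloid T) ∈ _
    rw [tabloidRep_polytabloid]
    exact polytabloid_mem _
  | zero => simp
  | add x y _ _ hx hy => rw [map_add]; exact add_mem hx hy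
  | smul a x _ hx => rw [map_smul]; exact Submodule.smul_mem _ _ hx

/-- Polytabloids of tableaux that agree on the long columns are equal. -/
theorem tabloidRep_polytabloid_congr {T : Tableau lam} {σ τ : Perm ℕ}
    (h : ∀ i ∈ longLabels T, σ i = τ i) :
    tabloidRep σ (polytabloid T) = tabloidRep τ (polytabloid T) := by
  rw [polytabloid, antisymm_apply, map_sum, map_sum]
  refine Finset.sum_congr rfl fun π _ => ?_
  rw [map_smul, map_smul, tabloidRep_single, tabloidRep_single, tabloidRep_single]
  congr 2
  -- Every tabloid occurring in `polytabloid T` vanishes off the long labels. So `σ⁻¹ i` and `τ⁻¹ i`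
  -- matter only if one of them is long, and then they are equal.
  have hz : ∀ j, j ∉ longLabels T → (rowOf T ∘ ⇑(π.1)⁻¹) j = 0 := fun j hj => by
    rw [Function.comp_apply, columnGroup_fix ((columnGroup T).inv_mem π.2) hj, rowOf_eq_zero hj]
  ext i
  change (rowOf T ∘ ⇑(π.1)⁻¹) (σ⁻¹ i) = (rowOf T ∘ ⇑(π.1)⁻¹) (τ⁻¹ i)
  by_cases h1 : σ⁻¹ i ∈ longLabels T
  · have := h _ h1
    rw [show σ (σ⁻¹ i) = i from σ.apply_symm_apply i] at this
    rw [Perm.eq_inv_iff_eq.mpr this.symm]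
  by_cases h2 : τ⁻¹ i ∈ longLabels T
  · have := h _ h2
    rw [show τ (τ⁻¹ i) = i from τ.apply_symm_apply i] at this
    rw [Perm.eq_inv_iff_eq.mpr this]
  rw [hz _ h1, hz _ h2]

/-- Finitely supported permutations already act transitively on the polytabloids; irreducibility
over the smaller group rests on this. -/
theorem exists_finPerm_polytabloid (T T' : Tableau lam) :
    ∃ σ ∈ finPerm, tabloidRep σ (polytabloid T) = polytabloid T' := by
  obtain ⟨σ, rfl⟩ := exists_relabel T T'
  obtain ⟨τ, hτ, h⟩ := exists_finPerm_eqOn σ (longLabels T)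
  exact ⟨τ, hτ, by rw [tabloidRep_polytabloid_congr h, tabloidRep_polytabloid]⟩

theorem polytabloid_relabel {T : Tableau lam} {σ : Perm ℕ} (hσ : σ ∈ columnGroup T) :
    polytabloid (relabel σ T) = ((finSign σ : ℤ) : ℚ) • polytabloid T := by
  rw [← tabloidRep_polytabloid]
  exact tabloidRep_antisymm (columnGroup_le_finPerm T) hσ _

/-! ### Linear independence of the standard polytabloids -/

theorem polytabloid_apply (T : Tableau lam) (t : ℕ → ℕ) : polytabloid T t =
    ∑ σ : columnGroup T, ((finSign σ.1 : ℤ) : ℚ) * Finsupp.single (rowOf T ∘ ⇑σ.1⁻¹) (1 : ℚ) t := by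
  rw [polytabloid, antisymm_apply, Finsupp.finsetSum_apply]
  simp only [tabloidRep_single, Finsupp.smul_apply, smul_eq_mul]

theorem exists_of_polytabloid_apply_ne_zero {T : Tableau lam} {t : ℕ → ℕ}
    (h : polytabloid T t ≠ 0) : ∃ σ ∈ columnGroup T, t = rowOf T ∘ ⇑σ⁻¹ := by
  classical
  rw [polytabloid_apply] at h
  obtain ⟨σ, -, hσ⟩ := Finset.exists_ne_zero_of_sum_ne_zero h
  refine ⟨σ.1, σ.2, ?_⟩
  by_contra hne
  exact hσ (by rw [Finsupp.single_eq_of_ne hne, mul_zero])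

theorem eq_one_of_rowOf_comp {T : Tableau lam} {σ : Perm ℕ} (hσ : σ ∈ columnGroup T)
    (h : rowOf T ∘ ⇑σ⁻¹ = rowOf T) : σ = 1 := by
  rw [← inv_eq_one]
  ext i
  exact label_ext T (congrFun h i) ((columnGroup T).inv_mem hσ i)

theorem polytabloid_apply_self (T : Tableau lam) : polytabloid T (rowOf T) = 1 := by
  classical
  rw [polytabloid_apply, Finset.sum_eq_single 1]
  · simp only [OneMemClass.coe_one, finSign_one, inv_one]
    simp
  · intro σ _ hσ
    rw [Finsupp.single_eq_of_ne, mul_zero]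
    intro h
    exact hσ (Subtype.ext (eq_one_of_rowOf_comp σ.2 h.symm))
  · simp

theorem polytabloid_ne_zero (T : Tableau lam) : polytabloid T ≠ 0 := fun h => by
  have := polytabloid_apply_self T
  simp [h] at this

/-- The colexicographic order on functions. -/
def ColexLT (t u : ℕ → ℕ) : Prop := ∃ i, t i < u i ∧ ∀ k, i < k → t k = u k

instance : IsStrictOrder (ℕ → ℕ) ColexLT where
  irrefl := by
    rintro t ⟨i, hi, -⟩
    exact lt_irrefl _ hi
  trans := by
    rintro t u v ⟨i, hi, hi'⟩ ⟨j, hj, hj'⟩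
    rcases lt_trichotomy i j with h | rfl | h
    · exact ⟨j, (hi' j h).trans_lt hj, fun k hk => (hi' k (h.trans hk)).trans (hj' k hk)⟩
    · exact ⟨i, hi.trans hj, fun k hk => (hi' k hk).trans (hj' k hk)⟩
    · exact ⟨i, hi.trans_eq (hj' i h), fun k hk => (hi' k hk).trans (hj' k (h.trans hk))⟩

/-- At the largest moved label `i`, the label `σ⁻¹ i` is smaller and in the same column, so
standardness puts it in a higher row. Thus the tabloid of a standard tableau is the leading term of
its polytabloid. -/
theorem colexLT_of_standard (T : InfSYT lam) {σ : Perm ℕ} (hσ : σ ∈ columnGroup T.box)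
    (h1 : σ ≠ 1) : ColexLT (rowOf T.box ∘ ⇑σ⁻¹) (rowOf T.box) := by
  have hinv := (columnGroup T.box).inv_mem hσ
  have hf := mem_finPerm_iff.mp (columnGroup_le_finPerm T.box hinv)
  have hne : hf.toFinset.Nonempty := by
    by_contra hempty
    rw [Finset.not_nonempty_iff_eq_empty] at hempty
    refine h1 (inv_eq_one.mp (Equiv.ext fun i => ?_))
    by_contra hi
    have : i ∈ hf.toFinset := by simpa using hi
    simp [hempty] at this
  obtain ⟨i, hi, hmax⟩ := hf.toFinset.exists_max_image id hne
  rw [Set.Finite.mem_toFinset, Set.mem_ofPred_eq] at hi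
  have hj : σ⁻¹ i < i := by
    refine lt_of_le_of_ne (hmax _ ?_) hi
    rw [Set.Finite.mem_toFinset, Set.mem_ofPred_eq]
    exact fun h => hi (σ⁻¹.injective h)
  refine ⟨i, ?_, fun k hk => ?_⟩
  · by_contra hlt
    rcases (not_lt.mp hlt).lt_or_eq with h | h
    · exact absurd (T.col_lt i (σ⁻¹ i) (hinv i).symm h) (not_lt.mpr hj.le)
    · exact hi (label_ext T.box h.symm (hinv i))
  · have : σ⁻¹ k = k := by
      by_contra hk'
      exact absurd (hmax k (by simpa using hk')) (not_le.mpr hk)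
    rw [Function.comp_apply, this]

/-- Rows increase, so the column of a label counts the smaller labels in its row. A standard tableau
is therefore determined by its tabloid. -/
theorem colOf_standard (T : InfSYT lam) (i : ℕ) :
    colOf T.box i = ((Finset.range i).filter fun k => rowOf T.box k = rowOf T.box i).card := by
  have himg : ((Finset.range i).filter fun k => rowOf T.box k = rowOf T.box i).image
      (colOf T.box) = Finset.range (colOf T.box i) := by
    ext c
    simp only [Finset.mem_image, Finset.mem_filter, Finset.mem_range]
    constructor
    · rintro ⟨k, ⟨hk, hr⟩, rfl⟩
      by_contra hc
      rcases (not_lt.mp hc).lt_or_eq with h | h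
      · exact absurd (T.row_lt i k hr.symm h) (not_lt.mpr hk.le)
      · exact hk.ne (label_ext T.box hr h.symm)
    · intro hc
      have hmem : (rowOf T.box i, c) ∈ lam.cells :=
        lam.isLowerSet (a := (T.box i).1) ⟨le_rfl, hc.le⟩ (T.box i).2
      refine ⟨T.box.symm ⟨_, hmem⟩, ⟨T.row_lt _ _ ?_ ?_, ?_⟩, ?_⟩
      · rw [apply_symm_apply]; rfl
      · rw [apply_symm_apply]; exact hc
      · rw [rowOf, apply_symm_apply]
      · rw [colOf, apply_symm_apply]
  rw [← Finset.card_range (colOf T.box i), ← himg, Finset.card_image_of_injOn]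
  intro k hk l hl h
  rw [Finset.mem_coe, Finset.mem_filter] at hk hl
  exact label_ext T.box (hk.2.trans hl.2.symm) h

theorem standard_ext {T S : InfSYT lam} (h : rowOf T.box = rowOf S.box) : T = S := by
  have hbox : T.box = S.box := by
    ext1 i
    refine Subtype.ext (Prod.ext (congrFun h i) ?_)
    change colOf T.box i = colOf S.box i
    rw [colOf_standard, colOf_standard, h]
  cases T
  cases S
  simp only at hbox
  subst hbox
  rfl

theorem linearIndependent_polytabloid (lam : InfDiagram) :
    LinearIndependent ℚ fun T : InfSYT lam => polytabloid T.box := by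
  classical
  rw [linearIndependent_iff]
  intro l hl
  by_contra hne
  have hsupp : l.support.Nonempty := Finsupp.support_nonempty_iff.mpr hne
  let s : Set (ℕ → ℕ) := (fun T : InfSYT lam => rowOf T.box) '' l.support
  have hs : s.Finite := l.support.finite_toSet.image _
  -- With the order reversed, a minimal element is a colexicographically greatest tabloid among the
  -- finitely many leading terms. No other polytabloid in the relation contains it, so its
  -- coefficient must vanish.
  have hwf : s.WellFoundedOn (Function.swap ColexLT) :=
    have : IsStrictOrder (ℕ → ℕ) (Function.swap ColexLT) := inferInstance
    hs.wellFoundedOn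
  obtain ⟨⟨t, ht⟩, -, hmin⟩ := hwf.has_min Set.univ
    (Set.nonempty_iff_univ_nonempty.mp (by
      obtain ⟨T, hT⟩ := hsupp
      exact ⟨⟨_, T, hT, rfl⟩⟩))
  obtain ⟨T, hT, rfl⟩ := ht
  have hcoef := DFunLike.congr_fun hl (rowOf T.box)
  rw [Finsupp.linearCombination_apply, Finsupp.sum, Finsupp.finsetSum_apply,
    Finset.sum_eq_single T] at hcoef
  · rw [Finsupp.smul_apply, polytabloid_apply_self, smul_eq_mul, mul_one] at hcoef
    exact (Finsupp.mem_support_iff.mp hT) hcoef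
  · intro S hS hST
    rw [Finsupp.smul_apply]
    by_contra hz
    obtain ⟨σ, hσ, heq⟩ := exists_of_polytabloid_apply_ne_zero (right_ne_zero_of_smul hz)
    by_cases h1 : σ = 1
    · subst h1
      rw [inv_one] at heq
      exact hST (standard_ext heq.symm)
    · have := colexLT_of_standard S hσ h1
      rw [← heq] at this
      exact hmin ⟨_, S, hS, rfl⟩ (Set.mem_univ _) this
  · intro h
    exact absurd hT h

/-! ### The Garnir relations -/

theorem finite_colLabels (T : Tableau lam) (j : ℕ) : {i | colOf T i = j}.Finite := by
  refine Set.Finite.of_finite_image (f := rowOf T)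
    ((Set.finite_lt_nat (lam.height j)).subset ?_) ?_
  · rintro _ ⟨i, rfl, rfl⟩
    exact rowOf_lt_height T i
  · intro i hi k hk h
    exact label_ext T h (hi.trans hk.symm)

/-- The labels in a given column. -/
noncomputable def colLabels (T : Tableau lam) (j : ℕ) : Finset ℕ := (finite_colLabels T j).toFinset

theorem mem_colLabels {T : Tableau lam} {j i : ℕ} : i ∈ colLabels T j ↔ colOf T i = j := by
  simp [colLabels]

theorem exists_label (T : Tableau lam) {r j : ℕ} (h : r < lam.height j) :
    ∃ i, rowOf T i = r ∧ colOf T i = j :=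
  ⟨T.symm ⟨(r, j), InfDiagram.mem_cells_iff.mpr h⟩, by rw [rowOf, apply_symm_apply],
    by rw [colOf, apply_symm_apply]⟩

theorem injOn_rowOf (T : Tableau lam) (j : ℕ) : Set.InjOn (rowOf T) (colLabels T j) := by
  intro i hi k hk h
  rw [Finset.mem_coe, mem_colLabels] at hi hk
  exact label_ext T h (hi.trans hk.symm)

theorem image_rowOf_colLabels (T : Tableau lam) (j : ℕ) :
    (colLabels T j).image (rowOf T) = Finset.range (lam.height j) := by
  ext r
  simp only [Finset.mem_image, mem_colLabels, Finset.mem_range]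
  constructor
  · rintro ⟨i, rfl, rfl⟩
    exact rowOf_lt_height T i
  · intro h
    obtain ⟨i, h1, h2⟩ := exists_label T h
    exact ⟨i, h2, h1⟩

theorem card_colLabels (T : Tableau lam) (j : ℕ) : (colLabels T j).card = lam.height j := by
  rw [← Finset.card_image_of_injOn (injOn_rowOf T j), image_rowOf_colLabels, Finset.card_range]

/-- The permutations that move only elements of `s`. -/
def permsOn (s : Finset ℕ) : Subgroup (Perm ℕ) where
  carrier := {σ | ∀ i, i ∉ s → σ i = i}
  one_mem' := fun _ _ => rfl
  mul_mem' := fun {σ τ} hσ hτ i hi => by rw [Perm.mul_apply, hτ i hi, hσ i hi]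
  inv_mem' := fun {σ} hσ i hi => Perm.inv_eq_iff_eq.mpr (hσ i hi).symm

theorem permsOn_le_finPerm (s : Finset ℕ) : permsOn s ≤ finPerm := by
  intro σ hσ
  rw [mem_finPerm_iff]
  exact s.finite_toSet.subset fun i hi => by_contra fun h => hi (hσ i h)

instance (s : Finset ℕ) : Finite (permsOn s) := finite_of_moved_mem s fun _ hσ => hσ

noncomputable instance (s : Finset ℕ) : Fintype (permsOn s) := Fintype.ofFinite _

theorem swap_mem_permsOn {s : Finset ℕ} {a b : ℕ} (ha : a ∈ s) (hb : b ∈ s) :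
    swap a b ∈ permsOn s := fun _ hi =>
  swap_apply_of_ne_of_ne (fun h => hi (h ▸ ha)) (fun h => hi (h ▸ hb))

theorem apply_mem_iff_of_mem_permsOn {s : Finset ℕ} {σ : Perm ℕ} (hσ : σ ∈ permsOn s) (i : ℕ) :
    σ i ∈ s ↔ i ∈ s :=
  mem_iff_of_moved_mem (fun i hi => by_contra fun h => hi (hσ i h)) i

/-- The labels in column `j`, in row `r` or below it. -/
noncomputable def garnirLeft (T : Tableau lam) (r j : ℕ) : Finset ℕ :=
  (colLabels T j).filter fun i => r ≤ rowOf T i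

/-- The labels in column `j + 1`, in row `r` or above it. -/
noncomputable def garnirRight (T : Tableau lam) (r j : ℕ) : Finset ℕ :=
  (colLabels T (j + 1)).filter fun i => rowOf T i ≤ r

theorem mem_garnirLeft {T : Tableau lam} {r j i : ℕ} :
    i ∈ garnirLeft T r j ↔ colOf T i = j ∧ r ≤ rowOf T i := by
  simp [garnirLeft, mem_colLabels]

theorem mem_garnirRight {T : Tableau lam} {r j i : ℕ} :
    i ∈ garnirRight T r j ↔ colOf T i = j + 1 ∧ rowOf T i ≤ r := by
  simp [garnirRight, mem_colLabels]

theorem card_garnirLeft (T : Tableau lam) (r j : ℕ) :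
    (garnirLeft T r j).card = lam.height j - r := by
  have himg : (garnirLeft T r j).image (rowOf T) = Finset.Ico r (lam.height j) := by
    ext k
    simp only [Finset.mem_image, mem_garnirLeft, Finset.mem_Ico]
    constructor
    · rintro ⟨i, ⟨rfl, h⟩, rfl⟩
      exact ⟨h, rowOf_lt_height T i⟩
    · rintro ⟨h, h'⟩
      obtain ⟨i, rfl, h2⟩ := exists_label T h'
      exact ⟨i, ⟨h2, h⟩, rfl⟩
  rw [← Finset.card_image_of_injOn (s := garnirLeft T r j) ((injOn_rowOf T j).mono (Finset.coe_subset.mpr (Finset.filter_subset _ _))), himg,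
    Nat.card_Ico]

theorem card_garnirRight (T : Tableau lam) {r j : ℕ} (h : r < lam.height (j + 1)) :
    (garnirRight T r j).card = r + 1 := by
  have himg : (garnirRight T r j).image (rowOf T) = Finset.range (r + 1) := by
    ext k
    simp only [Finset.mem_image, mem_garnirRight, Finset.mem_range]
    constructor
    · rintro ⟨i, ⟨-, h⟩, rfl⟩
      omega
    · intro h'
      obtain ⟨i, rfl, h2⟩ := exists_label T (lt_of_lt_of_le h' h)
      exact ⟨i, ⟨h2, by omega⟩, rfl⟩
  rw [← Finset.card_image_of_injOn (s := garnirRight T r j) ((injOn_rowOf T (j + 1)).mono (Finset.coe_subset.mpr (Finset.filter_subset _ _))), himg,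
    Finset.card_range]

/-- The labels involved in a Garnir relation. -/
noncomputable def garnirLabels (T : Tableau lam) (r j : ℕ) : Finset ℕ :=
  garnirLeft T r j ∪ garnirRight T r j

/-- There are `(height j - r) + (r + 1)` labels involved, one more than the rows available to them.
In each tabloid of the polytabloid two of them share a row, and their transposition makes the
antisymmetrizer vanish there. -/
theorem garnir_relation (T : Tableau lam) {r j : ℕ} (h : r < lam.height (j + 1)) :
    antisymm (permsOn (garnirLabels T r j)) (polytabloid T) = 0 := by
  classical
  have hj : lam.height (j + 1) ≤ lam.height j := InfDiagram.height_anti (Nat.le_succ j)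
  have hcard : (Finset.range (lam.height j)).card < (garnirLabels T r j).card := by
    rw [garnirLabels, Finset.card_union_of_disjoint, card_garnirLeft, card_garnirRight T h,
      Finset.card_range]
    · omega
    · rw [Finset.disjoint_left]
      intro i h1 h2
      rw [mem_garnirLeft] at h1
      rw [mem_garnirRight] at h2
      omega
  rw [polytabloid, antisymm_apply (columnGroup T), map_sum]
  refine Finset.sum_eq_zero fun π _ => ?_
  rw [map_smul, tabloidRep_single]
  have hinv := (columnGroup T).inv_mem π.2
  obtain ⟨a, ha, b, hb, hab, heq⟩ := Finset.exists_ne_map_eq_of_card_lt_of_maps_to hcard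
    (f := rowOf T ∘ ⇑π.1⁻¹) (fun i hi => by
      rw [Finset.mem_coe, Finset.mem_range, Function.comp_apply]
      have h1 := rowOf_lt_height T (π.1⁻¹ i)
      rw [hinv i] at h1
      rw [Finset.mem_coe, garnirLabels, Finset.mem_union, mem_garnirLeft, mem_garnirRight] at hi
      rcases hi with hi | hi
      · rwa [hi.1] at h1
      · rw [hi.1] at h1
        exact h1.trans_le hj)
  rw [antisymm_eq_zero (permsOn_le_finPerm _) hab (swap_mem_permsOn ha hb), smul_zero]
  rw [tabloidRep_single, comp_swap heq]

/-! ### Straightening -/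

/-- The sum of the labels in the long columns, with weights. -/
noncomputable def labelSum (w : ℕ × ℕ → ℕ) (T : Tableau lam) : ℕ :=
  ∑ c ∈ longCells lam, T.symm c * w c.1

/-- The shift `b` is free, because `σ` permutes `s` and the weight differences sum to zero. A good
choice of `b` controls the sign of every single term. -/
theorem labelSum_sub_labelSum {w : ℕ × ℕ → ℕ} (hw : ∀ c, lam.width ≤ c.2 → w c = 0)
    (T : Tableau lam) {s : Finset ℕ} {σ : Perm ℕ} (hσ : σ ∈ permsOn s) (b : ℤ) :
    (labelSum w T : ℤ) - labelSum w (relabel σ T) =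
      ∑ i ∈ s, ((i : ℤ) - b) * ((w (T i).1 : ℤ) - w (T (σ⁻¹ i)).1) := by
  classical
  have h1 : (labelSum w T : ℤ) - labelSum w (relabel σ T) =
      ∑ i ∈ longLabels T, ((i : ℤ) - σ i) * w (T i).1 := by
    rw [longLabels, Finset.sum_map, labelSum, labelSum]
    push_cast
    rw [← Finset.sum_sub_distrib]
    refine Finset.sum_congr rfl fun c _ => ?_
    simp [sub_mul]
  have h2 : ∑ i ∈ longLabels T, ((i : ℤ) - σ i) * w (T i).1 =
      ∑ i ∈ s, ((i : ℤ) - σ i) * w (T i).1 := by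
    trans ∑ i ∈ longLabels T ∪ s, ((i : ℤ) - σ i) * w (T i).1
    · refine Finset.sum_subset Finset.subset_union_left fun i _ hi => ?_
      rw [mem_longLabels, not_lt] at hi
      rw [hw _ hi]
      simp
    · refine (Finset.sum_subset Finset.subset_union_right fun i _ hi => ?_).symm
      rw [hσ i hi]
      simp
  have h3 : ∑ i ∈ s, ((i : ℤ) - b) * (w (T (σ⁻¹ i)).1 : ℤ) =
      ∑ i ∈ s, ((σ i : ℤ) - b) * (w (T i).1 : ℤ) := by
    symm
    refine Finset.sum_equiv σ (fun i => (apply_mem_iff_of_mem_permsOn hσ i).symm) fun i _ => ?_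
    rw [show σ⁻¹ (σ i) = i from σ.symm_apply_apply i]
  simp_rw [mul_sub]
  rw [h1, h2, Finset.sum_sub_distrib, h3, ← Finset.sum_sub_distrib]
  refine Finset.sum_congr rfl fun i _ => ?_
  ring

/-- The weight used to measure the distribution of the labels among the columns. -/
noncomputable def colWeight (lam : InfDiagram) (c : ℕ × ℕ) : ℕ := lam.width - c.2

/-- The weight used to measure the arrangement of the labels inside the columns. -/
noncomputable def rowWeight (lam : InfDiagram) (c : ℕ × ℕ) : ℕ :=
  if c.2 < lam.width then lam.height 0 - c.1 else 0

theorem exists_sorted_tail (T : Tableau lam) : ∃ T' : Tableau lam,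
    polytabloid T' = polytabloid T ∧ (∀ c ∈ longCells lam, T'.symm c = T.symm c) ∧
    ∀ i k, lam.width ≤ colOf T' i → colOf T' i < colOf T' k → i < k := by
  classical
  let U : Set ℕ := {i | lam.width ≤ colOf T i}
  have hrow : ∀ i ∈ U, rowOf T i = 0 := fun i hi =>
    rowOf_eq_zero (by rwa [mem_longLabels, not_lt])
  let e₂ : ℕ ≃ U :=
    { toFun := fun k => ⟨T.symm ⟨(0, lam.width + k), lam.firstRow _⟩, by
        change lam.width ≤ colOf T _
        rw [colOf, apply_symm_apply]
        exact Nat.le_add_right _ _⟩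
      invFun := fun i => colOf T i.1 - lam.width
      left_inv := fun k => by
        simp only [colOf, apply_symm_apply]
        omega
      right_inv := fun i => by
        apply Subtype.ext
        have hi : lam.width ≤ colOf T i.1 := i.2
        refine label_ext T ?_ ?_
        · rw [rowOf, apply_symm_apply, hrow i.1 i.2]
        · rw [colOf, apply_symm_apply]
          change lam.width + (colOf T i.1 - lam.width) = _
          omega }
  have : Infinite U := Infinite.of_injective e₂ e₂.injective
  let e₁ : ℕ ≃o U := Nat.Subtype.orderIsoOfNat U
  -- `e₂` lists the labels of the tail by column and `e₁` by size; `σ` matches the two lists and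
  -- fixes the long columns, so neither the polytabloid nor any `labelSum` changes.
  let σ : Perm ℕ := Perm.ofSubtype (p := (· ∈ U)) (e₂.symm.trans e₁.toEquiv)
  have hfix : ∀ i, i ∈ longLabels T → σ i = i := fun i hi =>
    Perm.ofSubtype_apply_of_not_mem _ (by
      rw [mem_longLabels] at hi
      exact not_le.mpr hi)
  have htail : ∀ k, σ (e₂ k) = e₁ k := fun k => by
    rw [show σ (e₂ k) = _ from Perm.ofSubtype_apply_coe _ _]
    simp
  refine ⟨relabel σ T, ?_, fun c hc => ?_, fun i k hi hik => ?_⟩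
  · rw [← tabloidRep_polytabloid, tabloidRep_polytabloid_congr (τ := 1) (by simpa using hfix),
      map_one, Module.End.one_apply]
  · rw [relabel_symm_apply]
    refine hfix _ ?_
    rw [mem_longLabels, colOf, apply_symm_apply]
    exact mem_longCells.mp hc
  · have key : ∀ l, lam.width ≤ colOf (relabel σ T) l →
        l = e₁ (colOf (relabel σ T) l - lam.width) := fun l hl => by
      have hl' : σ⁻¹ l ∈ U := hl
      rw [← htail]
      have : (e₂ (colOf (relabel σ T) l - lam.width) : ℕ) = σ⁻¹ l :=
        congrArg Subtype.val (e₂.right_inv ⟨σ⁻¹ l, hl'⟩)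
      rw [this]
      exact (σ.apply_symm_apply l).symm
    rw [key i hi, key k (hi.trans hik.le)]
    exact e₁.strictMono (by omega)

/-- Row-monotonicity can be tested on neighbouring boxes. -/
theorem lt_of_adjacent_lt (T : Tableau lam)
    (h : ∀ i k, rowOf T i = rowOf T k → colOf T k = colOf T i + 1 → i < k) {i k : ℕ}
    (hr : rowOf T i = rowOf T k) (hc : colOf T i < colOf T k) : i < k := by
  obtain ⟨d, hd⟩ := Nat.exists_eq_add_of_lt hc
  induction d generalizing k with
  | zero => exact h i k hr (by omega)
  | succ d ih =>
    have hmem : (rowOf T k, colOf T i + d + 1) ∈ lam.cells :=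
      lam.isLowerSet (a := (T k).1) ⟨le_rfl, by change _ ≤ colOf T k; omega⟩ (T k).2
    obtain ⟨m, hm, hm'⟩ := exists_label T (InfDiagram.mem_cells_iff.mp hmem)
    exact (ih (k := m) (hr.trans hm.symm) (by omega) hm').trans (h m k hm (by omega))

/-- The left labels exceed `b` and the right ones do not. A permutation outside the column group
moves some left label into column `j + 1`, where the weight is smaller by one; every exchange
between the columns lowers the sum or keeps it. -/
theorem labelSum_relabel_lt_of_garnir {T : Tableau lam} {r j b : ℕ} (hj : j < lam.width)
    (hl : ∀ i ∈ garnirLeft T r j, b < i) (hr : ∀ i ∈ garnirRight T r j, i ≤ b) {σ : Perm ℕ}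
    (hσ : σ ∈ permsOn (garnirLabels T r j)) (hσ' : σ ∉ columnGroup T) :
    labelSum (colWeight lam) (relabel σ T) < labelSum (colWeight lam) T := by
  classical
  have hinv := (permsOn _).inv_mem hσ
  have hmem := apply_mem_iff_of_mem_permsOn hinv
  have hwl : ∀ i ∈ garnirLeft T r j, colWeight lam (T i).1 = (lam.width - j - 1) + 1 :=
    fun i hi => by
      have h : (T i).1.2 = j := (mem_garnirLeft.mp hi).1
      rw [colWeight, h]
      omega
  have hwr : ∀ i ∈ garnirRight T r j, colWeight lam (T i).1 = lam.width - j - 1 :=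
    fun i hi => by
      have h : (T i).1.2 = j + 1 := (mem_garnirRight.mp hi).1
      rw [colWeight, h]
      omega
  have hdisj : ∀ i, i ∈ garnirLeft T r j → i ∉ garnirRight T r j := fun i h1 h2 => by
    rw [mem_garnirLeft] at h1
    rw [mem_garnirRight] at h2
    omega
  have hcases : ∀ i ∈ garnirLabels T r j, i ∈ garnirLeft T r j ∨ i ∈ garnirRight T r j :=
    fun i hi => Finset.mem_union.mp hi
  -- Otherwise, by finiteness, `σ⁻¹` would preserve the left part, hence also the right one, and
  -- would lie in the column group.
  have hex : ∃ i ∈ garnirLeft T r j, σ⁻¹ i ∉ garnirLeft T r j := by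
    by_contra! hall
    have hsub : (garnirLeft T r j).map (σ⁻¹ : Perm ℕ).toEmbedding ⊆ garnirLeft T r j := by
      intro x hx
      obtain ⟨i, hi, rfl⟩ := Finset.mem_map.mp hx
      exact hall i hi
    have heq := Finset.eq_of_subset_of_card_le hsub (by rw [Finset.card_map])
    have hback : ∀ i, σ⁻¹ i ∈ garnirLeft T r j → i ∈ garnirLeft T r j := fun i hi => by
      rw [← heq] at hi
      obtain ⟨k, hk, hki⟩ := Finset.mem_map.mp hi
      rwa [← σ⁻¹.injective hki]
    refine hσ' ((columnGroup T).inv_mem_iff.mp fun i => ?_)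
    by_cases hi : i ∈ garnirLabels T r j
    · rcases hcases i hi with h | h
      · rw [(mem_garnirLeft.mp (hall i h)).1, (mem_garnirLeft.mp h).1]
      · rcases hcases _ ((hmem i).mpr hi) with h' | h'
        · exact absurd h (hdisj i (hback i h'))
        · rw [(mem_garnirRight.mp h').1, (mem_garnirRight.mp h).1]
    · rw [hinv i hi]
  have hsum := labelSum_sub_labelSum (w := colWeight lam) (fun c hc => by
    rw [colWeight]
    omega) T hσ b
  suffices h : (0 : ℤ) < ∑ i ∈ garnirLabels T r j, ((i : ℤ) - b) *
      ((colWeight lam (T i).1 : ℤ) - colWeight lam (T (σ⁻¹ i)).1) by omega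
  refine Finset.sum_pos' (fun i hi => ?_) ?_
  · rcases hcases i hi with h | h <;> rcases hcases _ ((hmem i).mpr hi) with h' | h'
    · rw [hwl _ h, hwl _ h']
      simp
    · rw [hwl _ h, hwr _ h']
      have := hl i h
      push_cast
      simp
      omega
    · rw [hwr _ h, hwl _ h']
      have := hr i h
      push_cast
      simp
      omega
    · rw [hwr _ h, hwr _ h']
      simp
  · obtain ⟨i, hi, hi'⟩ := hex
    have hmi : i ∈ garnirLabels T r j := Finset.mem_union_left _ hi
    refine ⟨i, hmi, ?_⟩
    rw [hwl _ hi, hwr _ ((hcases _ ((hmem i).mpr hmi)).resolve_left hi')]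
    have := hl i hi
    push_cast
    simp
    omega

theorem labelSum_colWeight_relabel {T : Tableau lam} {σ : Perm ℕ} (hσ : σ ∈ columnGroup T) :
    labelSum (colWeight lam) (relabel σ T) = labelSum (colWeight lam) T := by
  have hmem : σ ∈ permsOn (longLabels T) := fun i hi => columnGroup_fix hσ hi
  have hsum := labelSum_sub_labelSum (w := colWeight lam) (fun c hc => by
    rw [colWeight]
    omega) T hmem 0
  rw [Finset.sum_eq_zero] at hsum
  · omega
  · intro i _
    have h : (T (σ⁻¹ i)).1.2 = (T i).1.2 := (columnGroup T).inv_mem hσ i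
    rw [colWeight, colWeight, h, sub_self, mul_zero]

theorem labelSum_rowWeight_swap {T : Tableau lam} {i k : ℕ} (hc : colOf T i = colOf T k)
    (hr : rowOf T i < rowOf T k) (hki : k < i) :
    labelSum (rowWeight lam) (relabel (swap i k) T) < labelSum (rowWeight lam) T := by
  classical
  have hsum := labelSum_sub_labelSum (w := rowWeight lam) (fun c hc => by
    rw [rowWeight, if_neg (not_lt.mpr hc)]) T
    (swap_mem_permsOn (s := {i, k}) (a := i) (b := k) (by simp) (by simp)) k
  -- The shift `b = k` leaves only the term of `i`, a product of two positive factors.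
  rw [Finset.sum_pair hki.ne', swap_inv, swap_apply_left, sub_self, zero_mul, add_zero] at hsum
  have hw := colOf_lt_width T (i := k) (by omega)
  have hh := (rowOf_lt_height T k).trans_le (InfDiagram.height_anti (Nat.zero_le _))
  have h1 : rowWeight lam (T i).1 = lam.height 0 - rowOf T i := if_pos (hc.trans_lt hw)
  have h2 : rowWeight lam (T k).1 = lam.height 0 - rowOf T k := if_pos hw
  have hpos : (0 : ℤ) < ((i : ℤ) - k) *
      ((rowWeight lam (T i).1 : ℤ) - rowWeight lam (T k).1) := by
    rw [h1, h2]
    apply mul_pos <;> omega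
  omega

/-- Well-founded induction on the pair of weighted sums, in lexicographic order. A column inversion
is undone by a transposition, which only changes the sign and lowers the second sum; a row inversion
is resolved by a Garnir relation, whose other terms have a smaller first sum. -/
theorem polytabloid_mem_span_standard (T : Tableau lam) :
    polytabloid T ∈ Submodule.span ℚ (Set.range fun S : InfSYT lam => polytabloid S.box) := by
  classical
  let μ : Tableau lam → ℕ ×ₗ ℕ := fun T =>
    toLex (labelSum (colWeight lam) T, labelSum (rowWeight lam) T)
  induction T using (InvImage.wf μ wellFounded_lt).induction with
  | _ T₀ ih =>
  obtain ⟨T, hpoly, hsymm, htail⟩ := exists_sorted_tail T₀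
  have hsum : ∀ w, labelSum w T₀ = labelSum w T := fun w =>
    Finset.sum_congr rfl fun c hc => by rw [hsymm c hc]
  rw [← hpoly]
  replace ih : ∀ S : Tableau lam, labelSum (colWeight lam) S < labelSum (colWeight lam) T ∨
      labelSum (colWeight lam) S = labelSum (colWeight lam) T ∧
      labelSum (rowWeight lam) S < labelSum (rowWeight lam) T →
      polytabloid S ∈ Submodule.span ℚ (Set.range fun S : InfSYT lam => polytabloid S.box) := by
    intro S hS
    refine ih S ?_
    change μ S < μ T₀
    rw [Prod.Lex.toLex_lt_toLex, hsum, hsum]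
    exact hS
  by_cases hcol : ∀ i k, colOf T i = colOf T k → rowOf T i < rowOf T k → i < k
  · by_cases hrow : ∀ i k, rowOf T i = rowOf T k → colOf T k = colOf T i + 1 → i < k
    · exact Submodule.subset_span ⟨⟨T, fun i k => lt_of_adjacent_lt T hrow, hcol⟩, rfl⟩
    · push Not at hrow
      obtain ⟨i, k, hr, hc, hki⟩ := hrow
      have hki : k < i := lt_of_le_of_ne hki fun h => by
        subst h
        omega
      -- The sorted tail has no inversions, so this one starts in a long column.
      have hj : colOf T i < lam.width := by
        by_contra hj
        exact absurd (htail i k (not_lt.mp hj) (by omega)) (not_lt.mpr hki.le)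
      have hh : rowOf T i < lam.height (colOf T i + 1) := by
        rw [hr, ← hc]
        exact rowOf_lt_height T k
      have hl : ∀ x ∈ garnirLeft T (rowOf T i) (colOf T i), k < x := fun x hx => by
        rw [mem_garnirLeft] at hx
        rcases hx.2.lt_or_eq with h | h
        · exact hki.trans (hcol i x hx.1.symm h)
        · rwa [← label_ext T h hx.1.symm]
      have hrt : ∀ x ∈ garnirRight T (rowOf T i) (colOf T i), x ≤ k := fun x hx => by
        rw [mem_garnirRight] at hx
        rcases hx.2.lt_or_eq with h | h
        · exact (hcol x k (by omega) (by omega)).le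
        · exact (label_ext T (h.trans hr) (by omega)).le
      have hrel := garnir_relation T hh
      rw [antisymm_apply, ← Finset.sum_filter_add_sum_filter_not _
        (fun σ => σ.1 ∈ columnGroup T)] at hrel
      -- For column permutations the two signs cancel, so these terms add up to a positive multiple
      -- of `polytabloid T`, which can be divided out over $\mathbb{Q}$.
      have h1 : ∀ σ ∈ Finset.univ.filter (fun σ : permsOn (garnirLabels T (rowOf T i)
          (colOf T i)) => σ.1 ∈ columnGroup T),
          ((finSign σ.1 : ℤ) : ℚ) • tabloidRep σ.1 (polytabloid T) = polytabloid T := by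
        intro σ hσ
        rw [tabloidRep_polytabloid, polytabloid_relabel (Finset.mem_filter.mp hσ).2, smul_smul,
          finSign_mul_self, one_smul]
      rw [Finset.sum_congr rfl h1, Finset.sum_const, ← Nat.cast_smul_eq_nsmul ℚ] at hrel
      have hcard : ((Finset.univ.filter (fun σ : permsOn (garnirLabels T (rowOf T i)
          (colOf T i)) => σ.1 ∈ columnGroup T)).card : ℚ) ≠ 0 := by
        rw [Nat.cast_ne_zero, ← Nat.pos_iff_ne_zero, Finset.card_pos]
        exact ⟨1, Finset.mem_filter.mpr ⟨Finset.mem_univ _, (columnGroup T).one_mem⟩⟩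
      rw [← Submodule.smul_mem_iff _ hcard, eq_neg_of_add_eq_zero_left hrel]
      refine Submodule.neg_mem _ (Submodule.sum_mem _ fun σ hσ => Submodule.smul_mem _ _ ?_)
      rw [tabloidRep_polytabloid]
      exact ih _ (Or.inl (labelSum_relabel_lt_of_garnir hj hl hrt σ.2 (Finset.mem_filter.mp hσ).2))
  · push Not at hcol
    obtain ⟨i, k, hc, hr, hki⟩ := hcol
    have hki : k < i := lt_of_le_of_ne hki fun h => by
      subst h
      omega
    have hs := swap_mem_columnGroup hc
    have hmem := ih (relabel (swap i k) T) (Or.inr ⟨labelSum_colWeight_relabel hs,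
      labelSum_rowWeight_swap hc hr hki⟩)
    rw [polytabloid_relabel hs, finSign_swap hki.ne'] at hmem
    simpa using hmem

theorem span_standard_polytabloid (lam : InfDiagram) :
    Submodule.span ℚ (Set.range fun S : InfSYT lam => polytabloid S.box) = spechtModule lam := by
  apply le_antisymm
  · refine Submodule.span_mono ?_
    rintro _ ⟨S, rfl⟩
    exact ⟨S.box, rfl⟩
  · refine Submodule.span_le.mpr ?_
    rintro _ ⟨T, rfl⟩
    exact polytabloid_mem_span_standard T

/-! ### Irreducibility of the Specht modules, and their classification -/

theorem nonempty_tableau (lam : InfDiagram) : Nonempty (Tableau lam) := by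
  have hinf : Infinite lam.cells :=
    Infinite.of_injective (fun j : ℕ => (⟨(0, j), lam.firstRow j⟩ : lam.cells)) fun i j h => by
      simpa using h
  obtain ⟨h⟩ := nonempty_denumerable lam.cells
  exact ⟨(Denumerable.eqv lam.cells).symm⟩

/-- A filling with different entries in every column can be sorted into one whose entries are
at least the row indices. -/
theorem exists_rowOf_le (T : Tableau lam) {t : ℕ → ℕ}
    (ht : ∀ i k, colOf T i = colOf T k → t i = t k → i = k) :
    ∃ π ∈ columnGroup T, ∀ i, rowOf T (π i) ≤ t i := by
  classical
  -- The rank of an entry within its column is its row after sorting. It is at most the entry, since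
  -- it counts distinct naturals below it.
  let rank : ℕ → ℕ := fun i => ((colLabels T (colOf T i)).filter fun k => t k < t i).card
  have hlt : ∀ i, rank i < lam.height (colOf T i) := fun i => by
    rw [← card_colLabels T]
    refine Finset.card_lt_card (Finset.filter_ssubset.mpr ⟨i, mem_colLabels.mpr rfl, lt_irrefl _⟩)
  have hle : ∀ i, rank i ≤ t i := fun i => by
    rw [← Finset.card_range (t i)]
    refine Finset.card_le_card_of_injOn t (fun k hk => ?_) fun k hk l hl h => ?_
    · simpa using (Finset.mem_filter.mp hk).2
    · have h1 := mem_colLabels.mp (Finset.mem_filter.mp hk).1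
      have h2 := mem_colLabels.mp (Finset.mem_filter.mp hl).1
      exact ht k l (h1.trans h2.symm) h
  have hmono : ∀ i k, colOf T i = colOf T k → t i < t k → rank i < rank k := fun i k hc h => by
    refine Finset.card_lt_card (Finset.ssubset_iff_of_subset (fun l hl => ?_) |>.mpr ⟨i, ?_, ?_⟩)
    · rw [Finset.mem_filter] at hl ⊢
      exact ⟨hc ▸ hl.1, hl.2.trans h⟩
    · rw [Finset.mem_filter, mem_colLabels]
      exact ⟨hc, h⟩
    · simp
  choose f hfr hfc using fun i => exists_label T (hlt i)
  have hinj : Function.Injective f := fun i k h => by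
    have hc : colOf T i = colOf T k := by rw [← hfc i, ← hfc k, h]
    have hr : rank i = rank k := by rw [← hfr i, ← hfr k, h]
    rcases lt_trichotomy (t i) (t k) with h' | h' | h'
    · exact absurd hr (hmono i k hc h').ne
    · exact ht i k hc h'
    · exact absurd hr (hmono k i hc.symm h').ne'
  have hsurj : Function.Surjective f := fun k => by
    have heq : (colLabels T (colOf T k)).image f = colLabels T (colOf T k) := by
      refine Finset.eq_of_subset_of_card_le (fun x hx => ?_) ?_
      · obtain ⟨i, hi, rfl⟩ := Finset.mem_image.mp hx
        rw [mem_colLabels] at hi ⊢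
        rw [hfc, hi]
      · rw [Finset.card_image_of_injective _ hinj]
    have hk : k ∈ colLabels T (colOf T k) := mem_colLabels.mpr rfl
    rw [← heq] at hk
    obtain ⟨i, -, hi⟩ := Finset.mem_image.mp hk
    exact ⟨i, hi⟩
  exact ⟨Equiv.ofBijective f ⟨hinj, hsurj⟩, hfc, fun i => (hfr i).trans_le (hle i)⟩

theorem finite_support_rowOf (T : Tableau lam) : (Function.support (rowOf T)).Finite :=
  (longLabels T).finite_toSet.subset fun _ hi => by_contra fun h => hi (rowOf_eq_zero h)

/-- The first row contributes zero, so this sum is a finite invariant of the shape; comparing it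
takes the place of the dominance order. -/
theorem finsum_rowOf_eq (T T' : Tableau lam) : ∑ᶠ i, rowOf T i = ∑ᶠ i, rowOf T' i := by
  obtain ⟨σ, rfl⟩ := exists_relabel T T'
  exact (finsum_comp_equiv σ⁻¹ (f := rowOf T)).symm

theorem eq_of_le_of_finsum_le {f g : ℕ → ℕ} (hg : (Function.support g).Finite)
    (hfg : ∀ i, f i ≤ g i) (h : ∑ᶠ i, g i ≤ ∑ᶠ i, f i) : f = g := by
  have hg' : Function.support g ⊆ (hg.toFinset : Set ℕ) := by simp
  have hf' : Function.support f ⊆ (hg.toFinset : Set ℕ) := fun i hi => hg' fun h0 => hi (by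
    have := hfg i
    omega)
  rw [finsum_eq_sum_of_support_subset _ hg', finsum_eq_sum_of_support_subset _ hf'] at h
  have hall := (Finset.sum_eq_sum_iff_of_le fun i _ => hfg i).mp
    (le_antisymm (Finset.sum_le_sum fun i _ => hfg i) h)
  ext i
  by_cases hi : i ∈ hg.toFinset
  · exact hall i hi
  · have h1 : g i = 0 := by simpa using hi
    have := hfg i
    omega

/-- Sorting the columns gives a pointwise inequality between row indices, and the assumed inequality
of the sums forces equality at every label. -/
theorem exists_rowOf_comp_eq {T : Tableau lam} {T' : Tableau lam'}
    (ht : ∀ i k, colOf T i = colOf T k → rowOf T' i = rowOf T' k → i = k)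
    (h : ∑ᶠ i, rowOf T' i ≤ ∑ᶠ i, rowOf T i) :
    ∃ π ∈ columnGroup T, rowOf T ∘ ⇑π = rowOf T' := by
  obtain ⟨π, hπ, hle⟩ := exists_rowOf_le T ht
  refine ⟨π, hπ, eq_of_le_of_finsum_le (finite_support_rowOf T') hle ?_⟩
  rwa [show ∑ᶠ i, (rowOf T ∘ ⇑π) i = _ from finsum_comp_equiv π (f := rowOf T)]

theorem injOn_columns_of_antisymm_ne_zero {T : Tableau lam} {t : ℕ → ℕ} {a : ℚ}
    (h : antisymm (columnGroup T) (Finsupp.single t a) ≠ 0) :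
    ∀ i k, colOf T i = colOf T k → t i = t k → i = k := by
  intro i k hc ht
  by_contra hne
  refine h (antisymm_eq_zero (columnGroup_le_finPerm T) hne (swap_mem_columnGroup hc) ?_)
  rw [tabloidRep_single, comp_swap ht]

/-- A tabloid that is not killed has distinct rows along each column of `T`; as the shapes agree, it
is a column permutation of the tabloid of `T`. -/
theorem antisymm_single_rowOf (T T' : Tableau lam) :
    ∃ c : ℚ, antisymm (columnGroup T) (Finsupp.single (rowOf T') 1) = c • polytabloid T := by
  by_cases h : antisymm (columnGroup T) (Finsupp.single (rowOf T') 1) = 0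
  · exact ⟨0, by rw [h, zero_smul]⟩
  obtain ⟨π, hπ, heq⟩ := exists_rowOf_comp_eq (injOn_columns_of_antisymm_ne_zero h)
    (finsum_rowOf_eq T' T).le
  have hinv := (columnGroup T).inv_mem hπ
  refine ⟨((finSign π⁻¹ : ℤ) : ℚ), ?_⟩
  rw [polytabloid, ← antisymm_tabloidRep (columnGroup_le_finPerm T) hinv, tabloidRep_single,
    inv_inv, heq]

theorem spechtModule_le_span_single (lam : InfDiagram) : spechtModule lam ≤
    Submodule.span ℚ (Set.range fun T : Tableau lam => Finsupp.single (rowOf T) (1 : ℚ)) := by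
  refine Submodule.span_le.mpr ?_
  rintro _ ⟨T, rfl⟩
  change polytabloid T ∈ _
  rw [polytabloid, antisymm_apply]
  refine Submodule.sum_mem _ fun σ _ => Submodule.smul_mem _ _ (Submodule.subset_span ?_)
  rw [tabloidRep_single]
  exact ⟨relabel σ.1 T, rfl⟩

theorem antisymm_mem_span (T : Tableau lam) {x : TabloidModule} (hx : x ∈ spechtModule lam) :
    ∃ c : ℚ, antisymm (columnGroup T) x = c • polytabloid T := by
  replace hx := spechtModule_le_span_single lam hx
  induction hx using Submodule.span_induction with
  | mem x hx =>
    obtain ⟨T', rfl⟩ := hx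
    exact antisymm_single_rowOf T T'
  | zero => exact ⟨0, by rw [map_zero, zero_smul]⟩
  | add x y _ _ hx hy =>
    obtain ⟨a, ha⟩ := hx
    obtain ⟨b, hb⟩ := hy
    exact ⟨a + b, by rw [map_add, ha, hb, add_smul]⟩
  | smul a x _ hx =>
    obtain ⟨b, hb⟩ := hx
    exact ⟨a * b, by rw [map_smul, hb, mul_smul]⟩

theorem finSign_inv {σ : Perm ℕ} (hσ : σ ∈ finPerm) : finSign σ⁻¹ = finSign σ := by
  have h := finSign_mul (finPerm.inv_mem hσ) hσ
  rw [inv_mul_cancel, finSign_one] at h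
  rw [mul_eq_one_iff_eq_inv.mp h.symm, Int.units_inv_eq_self]

/-- The antisymmetrizer computes the pairing with a polytabloid. -/
theorem linearCombination_polytabloid (w : TabloidModule) (T : Tableau lam) :
    Finsupp.linearCombination ℚ (w : (ℕ → ℕ) → ℚ) (polytabloid T) =
      antisymm (columnGroup T) w (rowOf T) := by
  rw [polytabloid, antisymm_apply, antisymm_apply, map_sum, Finsupp.finsetSum_apply]
  refine Fintype.sum_equiv (Equiv.inv _) _ _ fun σ => ?_
  rw [map_smul, tabloidRep_single, Finsupp.linearCombination_single, one_smul, Equiv.inv_apply,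
    Subgroup.coe_inv, finSign_inv (columnGroup_le_finPerm T σ.2), Finsupp.smul_apply,
    tabloidRep_apply]

/-- Such a `w` is orthogonal to all polytabloids, hence to itself, and a sum of rational squares
vanishes only termwise. -/
theorem eq_zero_of_antisymm_eq_zero {w : TabloidModule} (hw : w ∈ spechtModule lam)
    (h : ∀ T : Tableau lam, antisymm (columnGroup T) w = 0) : w = 0 := by
  have hker : spechtModule lam ≤
      LinearMap.ker (Finsupp.linearCombination ℚ (w : (ℕ → ℕ) → ℚ)) := by
    refine Submodule.span_le.mpr ?_
    rintro _ ⟨T, rfl⟩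
    change Finsupp.linearCombination ℚ (w : (ℕ → ℕ) → ℚ) (polytabloid T) = 0
    rw [linearCombination_polytabloid, h T, Finsupp.zero_apply]
  have h0 := hker hw
  rw [LinearMap.mem_ker, Finsupp.linearCombination_apply, Finsupp.sum] at h0
  simp only [smul_eq_mul] at h0
  rw [Finset.sum_eq_zero_iff_of_nonneg fun t _ => mul_self_nonneg _] at h0
  ext t
  by_cases ht : t ∈ w.support
  · simpa using h0 t ht
  · simpa using ht

/-- Any stable subspace of a Specht module is trivial. -/
theorem eq_bot_or_eq_spechtModule {W : Submodule ℚ TabloidModule} (hW : W ≤ spechtModule lam)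
    (hstab : ∀ σ ∈ finPerm, ∀ x ∈ W, tabloidRep σ x ∈ W) : W = ⊥ ∨ W = spechtModule lam := by
  by_cases hall : ∀ w ∈ W, ∀ T : Tableau lam, antisymm (columnGroup T) w = 0
  · exact Or.inl ((Submodule.eq_bot_iff _).mpr fun w hw =>
      eq_zero_of_antisymm_eq_zero (hW hw) (hall w hw))
  right
  push Not at hall
  obtain ⟨w, hw, T, hT⟩ := hall
  -- The nonzero antisymmetrized vector is a multiple of a polytabloid, so `W` contains that
  -- polytabloid and, by transitivity, all of them.
  obtain ⟨c, hc⟩ := antisymm_mem_span T (hW hw)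
  have hc0 : c ≠ 0 := by
    rintro rfl
    exact hT (by rw [hc, zero_smul])
  have hmem : polytabloid T ∈ W := by
    rw [← Submodule.smul_mem_iff _ hc0, ← hc, antisymm_apply]
    exact Submodule.sum_mem _ fun σ _ => Submodule.smul_mem _ _
      (hstab _ (columnGroup_le_finPerm T σ.2) _ hw)
  refine le_antisymm hW (Submodule.span_le.mpr ?_)
  rintro _ ⟨T', rfl⟩
  obtain ⟨σ, hσ, h⟩ := exists_finPerm_polytabloid T T'
  change polytabloid T' ∈ W
  rw [← h]
  exact hstab σ hσ _ hmem

/-- The image of a polytabloid transforms by the sign under the column group, so the antisymmetrizer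
multiplies it by the group order and does not kill it. Hence it does not kill some tabloid of shape
`lam'`, whose rows are then distinct along each column of `T`. -/
theorem exists_injOn_columns (f : spechtModule lam →ₗ[ℚ] TabloidModule)
    (hinj : Function.Injective f) (hf : ∀ x, f x ∈ spechtModule lam')
    (hequiv : ∀ σ ∈ finPerm, ∀ x : spechtModule lam,
      f ⟨tabloidRep σ x, tabloidRep_mem x.2 σ⟩ = tabloidRep σ (f x)) :
    ∃ (T : Tableau lam) (T' : Tableau lam'),
      ∀ i k, colOf T i = colOf T k → rowOf T' i = rowOf T' k → i = k := by
  obtain ⟨T⟩ := nonempty_tableau lam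
  let e : spechtModule lam := ⟨polytabloid T, polytabloid_mem T⟩
  have hcomm : antisymm (columnGroup T) (f e) = (Fintype.card (columnGroup T) : ℚ) • f e := by
    rw [antisymm_apply]
    have : ∀ σ : columnGroup T, ((finSign σ.1 : ℤ) : ℚ) • tabloidRep σ.1 (f e) = f e := by
      intro σ
      have h : (⟨tabloidRep σ.1 e, tabloidRep_mem e.2 σ.1⟩ : spechtModule lam) =
          ((finSign σ.1 : ℤ) : ℚ) • e :=
        Subtype.ext (tabloidRep_antisymm (columnGroup_le_finPerm T) σ.2 _)
      rw [← hequiv _ (columnGroup_le_finPerm T σ.2), h, map_smul, smul_smul, finSign_mul_self,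
        one_smul]
    rw [Finset.sum_congr rfl fun σ _ => this σ, Finset.sum_const, Finset.card_univ,
      Nat.cast_smul_eq_nsmul]
  have hfe : f e ≠ 0 := fun h => by
    have := hinj (h.trans (map_zero f).symm)
    exact polytabloid_ne_zero T (congrArg Subtype.val this)
  refine ⟨T, ?_⟩
  by_contra! hnone
  have hzero : antisymm (columnGroup T) (f e) = 0 := by
    have hle : Submodule.span ℚ (Set.range fun T' : Tableau lam' =>
        Finsupp.single (rowOf T') (1 : ℚ)) ≤ LinearMap.ker (antisymm (columnGroup T)) := by
      refine Submodule.span_le.mpr ?_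
      rintro _ ⟨T', rfl⟩
      by_contra hne
      obtain ⟨i, k, h1, h2, h3⟩ := hnone T'
      exact h3 (injOn_columns_of_antisymm_ne_zero hne i k h1 h2)
    exact hle (spechtModule_le_span_single lam' (hf e))
  rw [hcomm] at hzero
  exact smul_ne_zero (Nat.cast_ne_zero.mpr Fintype.card_ne_zero) hfe hzero

/-- The lengths of the finite rows can be read off the fibres of a tabloid. Row `0` is excluded
because `ncard` of its infinite fibre is zero. -/
theorem mem_cells_iff_lt_ncard (T : Tableau lam) {r : ℕ} (hr : r ≠ 0) (j : ℕ) :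
    (r, j) ∈ lam.cells ↔ j < {i | rowOf T i = r}.ncard := by
  obtain ⟨n, hn⟩ := exists_mem_iff_lt (s := {j | (r, j) ∈ lam.cells})
    (fun a b hab ha => lam.isLowerSet (a := (r, a)) ⟨le_rfl, hab⟩ ha)
    ((lam.finite_lower.image Prod.snd).subset fun j hj => ⟨(r, j), ⟨hj, hr⟩, rfl⟩)
  have himg : colOf T '' {i | rowOf T i = r} = Set.Iio n := by
    ext c
    rw [Set.mem_Iio, ← hn]
    constructor
    · rintro ⟨i, rfl, rfl⟩
      exact (T i).2
    · intro hc
      obtain ⟨i, h1, h2⟩ := exists_label T (InfDiagram.mem_cells_iff.mp hc)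
      exact ⟨i, h1, h2⟩
  have hinj : Set.InjOn (colOf T) {i | rowOf T i = r} := fun i hi k hk h =>
    label_ext T (Eq.trans hi (Eq.symm hk)) h
  rw [← hinj.ncard_image, himg, ← Nat.card_coe_set_eq]
  simpa using hn j

theorem diagram_eq_of_rowOf_comp {T : Tableau lam} {T' : Tableau lam'} {π : Perm ℕ}
    (h : rowOf T ∘ ⇑π = rowOf T') : lam = lam' := by
  ext ⟨r, j⟩
  rcases eq_or_ne r 0 with rfl | hr
  · exact iff_of_true (lam.firstRow j) (lam'.firstRow j)
  · rw [mem_cells_iff_lt_ncard (relabel π⁻¹ T) hr, mem_cells_iff_lt_ncard T' hr, rowOf_relabel,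
      inv_inv, h]

theorem diagram_eq_of_equiv (f : spechtModule lam ≃ₗ[ℚ] spechtModule lam')
    (hequiv : ∀ σ ∈ finPerm, ∀ x : spechtModule lam,
      (f ⟨tabloidRep σ x, tabloidRep_mem x.2 σ⟩ : TabloidModule) = tabloidRep σ (f x)) :
    lam = lam' := by
  obtain ⟨T, T', hT⟩ := exists_injOn_columns ((spechtModule lam').subtype ∘ₗ f.toLinearMap)
    (Subtype.val_injective.comp f.injective) (fun x => (f x).2) hequiv
  obtain ⟨S', S, hS⟩ := exists_injOn_columns (lam' := lam)
    ((spechtModule lam).subtype ∘ₗ f.symm.toLinearMap)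
    (Subtype.val_injective.comp f.symm.injective) (fun x => (f.symm x).2) fun σ hσ x => by
      have h : (⟨tabloidRep σ x, tabloidRep_mem x.2 σ⟩ : spechtModule lam') =
          f ⟨tabloidRep σ (f.symm x), tabloidRep_mem (f.symm x).2 σ⟩ :=
        Subtype.ext (by rw [hequiv σ hσ, f.apply_symm_apply])
      rw [h]
      simp
  -- `f` and its inverse provide column conditions in both directions; whichever way the sums
  -- compare, one of the two applies.
  by_cases hle : ∑ᶠ i, rowOf T' i ≤ ∑ᶠ i, rowOf T i
  · obtain ⟨π, -, h⟩ := exists_rowOf_comp_eq hT hle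
    exact diagram_eq_of_rowOf_comp h
  · rw [not_le, finsum_rowOf_eq T S, finsum_rowOf_eq T' S'] at hle
    obtain ⟨π, -, h⟩ := exists_rowOf_comp_eq hS hle.le
    exact (diagram_eq_of_rowOf_comp h).symm

/-! ### The map from the tabloid module to power series -/

theorem permRep_apply (σ : Perm ℕ) (f : PS) (d : ℕ →₀ ℕ) :
    permRep σ f d = f (d.mapDomain ⇑σ⁻¹) := by
  have h := MvPowerSeries.coeff_embDomain_rename (R := ℚ) σ.toEmbedding f (d.mapDomain ⇑σ⁻¹)
  have hd : Finsupp.embDomain σ.toEmbedding (d.mapDomain ⇑σ⁻¹) = d := by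
    rw [Finsupp.embDomain_eq_mapDomain]
    change Finsupp.mapDomain ⇑σ _ = d
    rw [← Finsupp.mapDomain_comp]
    convert Finsupp.mapDomain_id
    ext i
    exact σ.apply_symm_apply i
  rw [hd] at h
  exact h

theorem permRep_mul_apply (σ : Perm ℕ) (f g : PS) :
    permRep σ (f * g) = permRep σ f * permRep σ g :=
  map_mul (MvPowerSeries.renameEquiv ℚ σ) f g

theorem mapDomain_perm_apply (σ : Perm ℕ) (p : ℕ →₀ ℕ) (i : ℕ) :
    p.mapDomain ⇑σ i = p (σ⁻¹ i) := by
  conv_lhs => rw [← σ.apply_symm_apply i]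
  exact Finsupp.mapDomain_apply σ.injective p _

/-- The leading exponents for an arbitrary tableau. -/
def IsLeading (M : InfSSYT lam) (T : Tableau lam) (p : ℕ →₀ ℕ) : Prop :=
  (∀ i, ∀ h : (T i).1.1 ≠ 0, p i = M.filling ⟨(T i).1, (T i).2, h⟩) ∧
  ∀ h, 0 < h → {i | rowOf T i = 0 ∧ p i = h}.ncard = M.mult h

/-- The exponents in the row orbit of the leading ones. -/
def leadingOrbit (M : InfSSYT lam) (T : Tableau lam) : Set (ℕ →₀ ℕ) :=
  {d | ∃ p, IsLeading M T p ∧ ∃ τ : Perm ℕ, (∀ i, rowOf T (τ i) = rowOf T i) ∧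
    d = p.mapDomain τ}

theorem IsLeading.relabel {M : InfSSYT lam} {T : Tableau lam} {p : ℕ →₀ ℕ}
    (hp : IsLeading M T p) (σ : Perm ℕ) :
    IsLeading M (relabel σ T) (p.mapDomain ⇑σ) := by
  refine ⟨fun i h => ?_, fun h hh => ?_⟩
  · rw [mapDomain_perm_apply]
    exact hp.1 (σ⁻¹ i) h
  · refine Eq.trans ?_ ((Set.ncard_image_of_injective _ σ.injective).trans (hp.2 h hh))
    congr 1
    ext i
    constructor
    · rintro ⟨h1, h2⟩
      rw [mapDomain_perm_apply] at h2
      exact ⟨σ⁻¹ i, ⟨h1, h2⟩, σ.apply_symm_apply i⟩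
    · rintro ⟨k, ⟨h1, h2⟩, rfl⟩
      have hk : σ⁻¹ (σ k) = k := σ.symm_apply_apply k
      refine ⟨?_, ?_⟩
      · rw [rowOf_relabel, Function.comp_apply, hk, h1]
      · rw [mapDomain_perm_apply, hk, h2]

theorem mapDomain_mem_leadingOrbit {M : InfSSYT lam} {T : Tableau lam} {d : ℕ →₀ ℕ}
    (hd : d ∈ leadingOrbit M T) (σ : Perm ℕ) :
    d.mapDomain ⇑σ ∈ leadingOrbit M (relabel σ T) := by
  obtain ⟨p, hp, τ, hτ, rfl⟩ := hd
  refine ⟨_, hp.relabel σ, σ * τ * σ⁻¹, fun i => ?_, ?_⟩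
  · simpa [rowOf_relabel] using hτ (σ⁻¹ i)
  · rw [← Finsupp.mapDomain_comp, ← Finsupp.mapDomain_comp]
    congr 1
    ext i
    simp

theorem mapDomain_inv_mapDomain (σ : Perm ℕ) (d : ℕ →₀ ℕ) :
    (d.mapDomain ⇑σ⁻¹).mapDomain ⇑σ = d := by
  ext i
  rw [mapDomain_perm_apply, mapDomain_perm_apply, inv_inv]
  exact congrArg d (σ.apply_symm_apply i)

theorem mem_leadingOrbit_relabel {M : InfSSYT lam} {T : Tableau lam} {d : ℕ →₀ ℕ} {σ : Perm ℕ} :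
    d ∈ leadingOrbit M (relabel σ T) ↔ d.mapDomain ⇑σ⁻¹ ∈ leadingOrbit M T := by
  constructor
  · intro h
    have := mapDomain_mem_leadingOrbit h σ⁻¹
    have hT : relabel σ⁻¹ (relabel σ T) = T := by
      ext i : 1
      simp
    rwa [hT] at this
  · intro h
    have := mapDomain_mem_leadingOrbit h σ
    rwa [mapDomain_inv_mapDomain] at this

theorem mapDomain_mem_leadingOrbit_of_row {M : InfSSYT lam} {T : Tableau lam} {d : ℕ →₀ ℕ}
    (hd : d ∈ leadingOrbit M T) {σ : Perm ℕ} (hσ : ∀ i, rowOf T (σ i) = rowOf T i) :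
    d.mapDomain ⇑σ ∈ leadingOrbit M T := by
  obtain ⟨p, hp, τ, hτ, rfl⟩ := hd
  refine ⟨p, hp, σ * τ, fun i => (hσ _).trans (hτ i), ?_⟩
  rw [← Finsupp.mapDomain_comp]
  rfl

/-- Tableaux with the same tabloid differ by a row permutation, so the orbit depends only on the
tabloid. -/
theorem leadingOrbit_subset {M : InfSSYT lam} {T T' : Tableau lam} (h : rowOf T = rowOf T') :
    leadingOrbit M T' ⊆ leadingOrbit M T := by
  obtain ⟨σ, rfl⟩ := exists_relabel T T'
  intro d hd
  rw [mem_leadingOrbit_relabel] at hd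
  have := mapDomain_mem_leadingOrbit_of_row hd (σ := σ) fun i => by
    have h' := congrFun h (σ i)
    rw [h', rowOf_relabel]
    exact congrArg (rowOf T) (σ.symm_apply_apply i)
  rwa [mapDomain_inv_mapDomain] at this

open scoped Classical in
/-- The orbit sum attached to a tabloid, which is zero for functions that are not tabloids. -/
noncomputable def tabloidSeries (M : InfSSYT lam) (t : ℕ → ℕ) : PS := fun d =>
  if ∃ T : Tableau lam, rowOf T = t ∧ d ∈ leadingOrbit M T then 1 else 0

theorem exists_mem_leadingOrbit_iff {M : InfSSYT lam} {T : Tableau lam} {d : ℕ →₀ ℕ} :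
    (∃ T' : Tableau lam, rowOf T' = rowOf T ∧ d ∈ leadingOrbit M T') ↔ d ∈ leadingOrbit M T :=
  ⟨fun ⟨_, h, hd⟩ => leadingOrbit_subset h.symm hd, fun h => ⟨T, rfl, h⟩⟩

theorem tabloidSeries_box (M : InfSSYT lam) (T : InfSYT lam) :
    tabloidSeries M (rowOf T.box) = rowOrbitSum M T := by
  classical
  funext d
  rw [tabloidSeries, rowOrbitSum]
  exact if_congr exists_mem_leadingOrbit_iff rfl rfl

theorem permRep_tabloidSeries (M : InfSSYT lam) (σ : Perm ℕ) (t : ℕ → ℕ) :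
    permRep σ (tabloidSeries M t) = tabloidSeries M (t ∘ ⇑σ⁻¹) := by
  classical
  funext d
  rw [permRep_apply, tabloidSeries, tabloidSeries]
  refine if_congr ⟨?_, ?_⟩ rfl rfl
  · rintro ⟨T, rfl, hd⟩
    exact ⟨relabel σ T, rfl, mem_leadingOrbit_relabel.mpr hd⟩
  · rintro ⟨T, hT, hd⟩
    refine ⟨relabel σ⁻¹ T, ?_, mem_leadingOrbit_relabel.mpr ?_⟩
    · rw [rowOf_relabel, hT]
      ext i
      simp
    · rwa [inv_inv, mapDomain_inv_mapDomain]

/-- The equivariant map that takes a tabloid to its orbit sum. -/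
noncomputable def toSeries (M : InfSSYT lam) : TabloidModule →ₗ[ℚ] PS :=
  Finsupp.linearCombination ℚ (tabloidSeries M)

theorem toSeries_single (M : InfSSYT lam) (t : ℕ → ℕ) :
    toSeries M (Finsupp.single t 1) = tabloidSeries M t := by
  rw [toSeries, Finsupp.linearCombination_single, one_smul]

theorem toSeries_tabloidRep (M : InfSSYT lam) (σ : Perm ℕ) (x : TabloidModule) :
    toSeries M (tabloidRep σ x) = permRep σ (toSeries M x) := by
  have h : toSeries M ∘ₗ tabloidRep σ = permRep σ ∘ₗ toSeries M := by
    refine Finsupp.lhom_ext' fun t => LinearMap.ext_ring ?_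
    change toSeries M (tabloidRep σ (Finsupp.single t 1)) =
      permRep σ (toSeries M (Finsupp.single t 1))
    rw [tabloidRep_single, toSeries_single, toSeries_single, permRep_tabloidSeries]
  exact LinearMap.congr_fun h x

theorem toSeries_polytabloid (M : InfSSYT lam) (T : InfSYT lam) :
    toSeries M (polytabloid T.box) = F M T := by
  rw [polytabloid, antisymm_apply, map_sum, F]
  refine Fintype.sum_equiv (Equiv.refl _) _ _ fun σ => ?_
  rw [map_smul, toSeries_tabloidRep, toSeries_single, tabloidSeries_box]
  rfl

/-- A list continued by zeros realizes prescribed multiplicities of positive entries along the first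
row. Finiteness is proved alongside because the induction step for `ncard` needs it. -/
theorem ncard_getD_eq_count (l : List ℕ) {h : ℕ} (hh : 0 < h) :
    {k | l.getD k 0 = h}.Finite ∧ {k | l.getD k 0 = h}.ncard = l.count h := by
  induction l with
  | nil =>
    have : {k : ℕ | ([] : List ℕ).getD k 0 = h} = ∅ := by
      ext k
      simp [hh.ne]
    rw [this]
    simp
  | cons a l ih =>
    have hinj : Function.Injective Nat.succ := Nat.succ_injective
    have hzero : 0 ∉ Nat.succ '' {k | l.getD k 0 = h} := by simp
    by_cases ha : a = h
    · have : {k | (a :: l).getD k 0 = h} = insert 0 (Nat.succ '' {k | l.getD k 0 = h}) := by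
        ext (_ | k) <;> simp [ha]
      rw [this]
      refine ⟨(ih.1.image _).insert _, ?_⟩
      rw [Set.ncard_insert_of_notMem hzero (ih.1.image _), Set.ncard_image_of_injective _ hinj,
        ih.2, ha, List.count_cons_self]
    · have : {k | (a :: l).getD k 0 = h} = Nat.succ '' {k | l.getD k 0 = h} := by
        ext (_ | k) <;> simp [ha]
      rw [this]
      refine ⟨ih.1.image _, ?_⟩
      rw [Set.ncard_image_of_injective _ hinj, ih.2, List.count_cons_of_ne ha]

/-- There is a leading exponent that increases strictly along the columns. -/
theorem exists_isLeading (M : InfSSYT lam) (T : Tableau lam) : ∃ p, IsLeading M T p ∧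
    ∀ i k, colOf T i = colOf T k → rowOf T i < rowOf T k → p i < p k := by
  classical
  let l : List ℕ := (Finsupp.toMultiset M.mult).toList
  have hl : ∀ h, l.count h = M.mult h := fun h => by
    rw [← Multiset.coe_count, Multiset.coe_toList, Finsupp.count_toMultiset]
  -- The positive entries of the first row go into boxes with nothing below them. Every long column
  -- then starts with zero, followed by the positive entries of the filling.
  let p : ℕ → ℕ := fun i =>
    if h : (T i).1.1 ≠ 0 then M.filling ⟨(T i).1, (T i).2, h⟩
    else if lam.width ≤ colOf T i then l.getD (colOf T i - lam.width) 0 else 0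
  have hp0 : ∀ i, rowOf T i = 0 → p i =
      if lam.width ≤ colOf T i then l.getD (colOf T i - lam.width) 0 else 0 := fun i hi =>
    dif_neg (not_not.mpr hi)
  have hp1 : ∀ i, ∀ h : (T i).1.1 ≠ 0, p i = M.filling ⟨(T i).1, (T i).2, h⟩ := fun i h =>
    dif_pos h
  have hfin : (Function.support p).Finite := by
    let g : ℕ → ℕ := fun k => T.symm ⟨(0, lam.width + k), lam.firstRow _⟩
    refine (((longLabels T).finite_toSet).union
      ((Set.finite_lt_nat l.length).image g)).subset fun i hi => ?_
    by_cases hlong : i ∈ longLabels T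
    · exact Or.inl hlong
    · right
      have hr := rowOf_eq_zero hlong
      rw [mem_longLabels, not_lt] at hlong
      rw [Function.mem_support, hp0 i hr, if_pos hlong] at hi
      refine ⟨colOf T i - lam.width, ?_, ?_⟩
      · by_contra hlt
        exact hi (List.getD_eq_default _ _ (not_lt.mp hlt))
      · refine label_ext T ?_ ?_
        · rw [rowOf, apply_symm_apply, hr]
        · rw [colOf, apply_symm_apply]
          change lam.width + (colOf T i - lam.width) = _
          omega
  refine ⟨Finsupp.ofSupportFinite p hfin, ⟨hp1, fun h hh => ?_⟩, fun i k hc hr => ?_⟩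
  · let g : ℕ → ℕ := fun k => T.symm ⟨(0, lam.width + k), lam.firstRow _⟩
    have hginj : Function.Injective g := fun a b hab => by
      have := T.symm.injective hab
      simpa using this
    refine Eq.trans ?_ ((Set.ncard_image_of_injective _ hginj).trans
      ((ncard_getD_eq_count l hh).2.trans (hl h)))
    congr 1
    ext i
    constructor
    · rintro ⟨hr, hpi⟩
      change p i = h at hpi
      rw [hp0 i hr] at hpi
      have hw : lam.width ≤ colOf T i := by
        by_contra hw
        rw [if_neg hw] at hpi
        exact hh.ne hpi
      rw [if_pos hw] at hpi
      refine ⟨_, hpi, label_ext T ?_ ?_⟩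
      · rw [rowOf, apply_symm_apply, hr]
      · rw [colOf, apply_symm_apply]
        change lam.width + (colOf T i - lam.width) = _
        omega
    · rintro ⟨k, hk, rfl⟩
      have h1 : rowOf T (g k) = 0 := by rw [rowOf, apply_symm_apply]
      have h2 : colOf T (g k) = lam.width + k := by rw [colOf, apply_symm_apply]
      refine ⟨h1, ?_⟩
      change p (g k) = h
      rw [hp0 _ h1, h2, if_pos (Nat.le_add_right _ _), Nat.add_sub_cancel_left]
      exact hk
  · change p i < p k
    have hk : (T k).1.1 ≠ 0 := (Nat.zero_le _).trans_lt hr |>.ne'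
    rw [hp1 k hk]
    by_cases hi : rowOf T i = 0
    · rw [hp0 i hi, if_neg]
      · exact M.pos _
      · rw [hc, not_le]
        exact colOf_lt_width T hk
    · rw [hp1 i hi]
      exact M.col_lt _ _ hc hr

/-- A leading exponent that increases along the columns belongs to just one of the orbits that
contribute to a Specht polynomial. -/
theorem eq_one_of_mapDomain_mem_leadingOrbit {M : InfSSYT lam} {T : Tableau lam} {p : ℕ →₀ ℕ}
    (hp : IsLeading M T p)
    (hcol : ∀ i k, colOf T i = colOf T k → rowOf T i < rowOf T k → p i < p k) {σ : Perm ℕ}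
    (hσ : σ ∈ columnGroup T) (hmem : p.mapDomain ⇑σ⁻¹ ∈ leadingOrbit M T) : σ = 1 := by
  classical
  obtain ⟨q, hq, τ, hτ, heq⟩ := hmem
  by_contra h1
  have hinv := (columnGroup T).inv_mem hσ
  have hf := mem_finPerm_iff.mp (columnGroup_le_finPerm T hinv)
  have hne : hf.toFinset.Nonempty := by
    by_contra hempty
    rw [Finset.not_nonempty_iff_eq_empty] at hempty
    refine h1 (inv_eq_one.mp (Equiv.ext fun i => ?_))
    by_contra hi
    have : i ∈ hf.toFinset := by simpa using hi
    simp [hempty] at this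
  obtain ⟨m, hm, hmax⟩ := hf.toFinset.exists_max_image p hne
  rw [Set.Finite.mem_toFinset, Set.mem_ofPred_eq] at hm
  -- Here `m` is a moved label with the largest exponent. The total row index of the labels with
  -- this exponent is the same on the whole leading orbit, since the first row contributes zero and
  -- row permutations preserve it.
  let rowSum : (ℕ → ℕ) → ℕ := fun d => ∑ᶠ i, if d i = p m then rowOf T i else 0
  have hpq : rowSum q = rowSum p := finsum_congr fun i => by
    by_cases hi : rowOf T i = 0
    · simp [hi]
    · rw [hp.1 i hi, hq.1 i hi]
  have hqσ : rowSum (q.mapDomain ⇑τ) = rowSum q := by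
    refine (finsum_comp_equiv τ).symm.trans (finsum_congr fun i => ?_)
    rw [hτ i, mapDomain_perm_apply, show τ⁻¹ (τ i) = i from τ.symm_apply_apply i]
  have hpσ : rowSum (p.mapDomain ⇑σ⁻¹) = ∑ᶠ i, if p i = p m then rowOf T (σ⁻¹ i) else 0 := by
    refine (finsum_comp_equiv σ⁻¹).symm.trans (finsum_congr fun i => ?_)
    rw [mapDomain_perm_apply, inv_inv, show σ (σ⁻¹ i) = i from σ.apply_symm_apply i]
  -- A label with this exponent cannot be moved down its column: it would reach the place of a moved
  -- label with a still larger exponent. As the totals agree, `m` keeps its row and so is fixed.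
  have hle : ∀ i, (if p i = p m then rowOf T (σ⁻¹ i) else 0) ≤
      if p i = p m then rowOf T i else 0 := fun i => by
    split_ifs with hi
    · by_contra hlt
      have hmoved : σ⁻¹ i ≠ i := fun h => hlt (by rw [h])
      have := hmax (σ⁻¹ i) (by
        rw [Set.Finite.mem_toFinset, Set.mem_ofPred_eq]
        exact fun h => hmoved (σ⁻¹.injective h))
      exact absurd (hcol i (σ⁻¹ i) (hinv i).symm (not_le.mp hlt)) (by omega)
    · exact le_rfl
  have hsupp : (Function.support fun i => if p i = p m then rowOf T i else 0).Finite :=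
    (finite_support_rowOf T).subset fun i hi h => hi (by
      simp [h])
  have hfun := eq_of_le_of_finsum_le hsupp hle (by
    rw [← hpσ, heq, hqσ, hpq])
  have := congrFun hfun m
  simp only [if_true] at this
  exact hm (label_ext T this (hinv m))

/-- The monomial with exponents increasing down the columns has coefficient $1$: among the column
permutations only the identity contributes to it. -/
theorem toSeries_polytabloid_ne_zero (M : InfSSYT lam) (T : Tableau lam) :
    toSeries M (polytabloid T) ≠ 0 := by
  classical
  obtain ⟨p, hp, hcol⟩ := exists_isLeading M T
  intro h
  have hcoef : MvPowerSeries.coeff p (toSeries M (polytabloid T)) =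
      ∑ σ : columnGroup T, ((finSign σ.1 : ℤ) : ℚ) * tabloidSeries M (rowOf T ∘ ⇑σ.1⁻¹) p := by
    rw [polytabloid, antisymm_apply, map_sum, map_sum]
    refine Finset.sum_congr rfl fun σ _ => ?_
    rw [map_smul, tabloidRep_single, toSeries_single]
    rfl
  have hval : ∀ σ : Perm ℕ, tabloidSeries M (rowOf T ∘ ⇑σ⁻¹) p =
      if p.mapDomain ⇑σ⁻¹ ∈ leadingOrbit M T then 1 else 0 := fun σ => by
    rw [← rowOf_relabel, tabloidSeries]
    exact if_congr (exists_mem_leadingOrbit_iff.trans mem_leadingOrbit_relabel) rfl rfl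
  rw [h, map_zero, Finset.sum_eq_single 1] at hcoef
  · rw [OneMemClass.coe_one, hval, finSign_one, if_pos] at hcoef
    · simp at hcoef
    · refine ⟨p, hp, 1, fun _ => rfl, by rw [inv_one]⟩
  · intro σ _ hσ
    rw [hval, if_neg, mul_zero]
    exact fun hmem => hσ (Subtype.ext (eq_one_of_mapDomain_mem_leadingOrbit hp hcol σ.2 hmem))
  · simp

/-- The kernel is a stable subspace of an irreducible module, and it omits the polytabloids. -/
theorem toSeries_injOn (M : InfSSYT lam) {x : TabloidModule} (hx : x ∈ spechtModule lam)
    (h : toSeries M x = 0) : x = 0 := by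
  have hW := eq_bot_or_eq_spechtModule (W := spechtModule lam ⊓ LinearMap.ker (toSeries M))
    inf_le_left fun σ _ y hy => ⟨tabloidRep_mem hy.1 σ, by
      rw [SetLike.mem_coe, LinearMap.mem_ker, toSeries_tabloidRep, LinearMap.mem_ker.mp hy.2,
        map_zero]⟩
  rcases hW with hW | hW
  · have : x ∈ spechtModule lam ⊓ LinearMap.ker (toSeries M) := ⟨hx, h⟩
    rwa [hW, Submodule.mem_bot] at this
  · obtain ⟨T⟩ := nonempty_tableau lam
    have hT := polytabloid_mem T
    rw [← hW] at hT
    exact absurd hT.2 (toSeries_polytabloid_ne_zero M T)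

/-! ### Multiplication by elementary symmetric functions -/

theorem permRep_esymm (σ : Perm ℕ) (r : ℕ) : permRep σ (esymm r) = esymm r := by
  classical
  funext d
  rw [permRep_apply, esymm]
  refine if_congr (and_congr ⟨fun h i => ?_, fun h i => ?_⟩ ?_) rfl rfl
  · have := h (σ⁻¹ i)
    rwa [mapDomain_perm_apply, inv_inv, show σ (σ⁻¹ i) = i from σ.apply_symm_apply i] at this
  · rw [mapDomain_perm_apply]
    exact h _
  · rw [Finsupp.degree_mapDomain]

theorem esymm_zero : esymm 0 = 1 := by
  classical
  ext d
  rw [MvPowerSeries.coeff_one]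
  change (if (∀ i, d i ≤ 1) ∧ d.degree = 0 then (1 : ℚ) else 0) = _
  refine if_congr ⟨fun h => (Finsupp.degree_eq_zero_iff d).mp h.2, ?_⟩ rfl rfl
  rintro rfl
  simp

theorem esymm_ne_zero (r : ℕ) : esymm r ≠ 0 := by
  classical
  let d : ℕ →₀ ℕ := ∑ i ∈ Finset.range r, Finsupp.single i 1
  have hd : esymm r d = 1 := by
    refine if_pos ⟨fun i => ?_, ?_⟩
    · rw [Finsupp.finsetSum_apply]
      simp only [Finsupp.single_apply, Finset.sum_ite_eq']
      split_ifs <;> simp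
    · simp [d]
  intro h
  rw [h] at hd
  exact zero_ne_one hd

theorem permRep_pow (σ : Perm ℕ) (f : PS) (k : ℕ) : permRep σ (f ^ k) = permRep σ f ^ k :=
  map_pow (MvPowerSeries.renameEquiv ℚ σ) f k

theorem permRep_esymmProd (σ : Perm ℕ) (h : ℕ →₀ ℕ) : permRep σ (esymmProd h) = esymmProd h := by
  rw [esymmProd, Finsupp.prod]
  refine (map_prod (MvPowerSeries.renameEquiv ℚ σ) _ _).trans (Finset.prod_congr rfl fun r _ => ?_)
  change permRep σ _ = _
  rw [permRep_pow, permRep_esymm]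

theorem esymmProd_ne_zero (h : ℕ →₀ ℕ) : esymmProd h ≠ 0 :=
  Finset.prod_ne_zero_iff.mpr fun r _ => pow_ne_zero _ (esymm_ne_zero r)

/-- The multiplicity of `0` can be erased because $e_0=1$. -/
theorem prod_map_esymm (A : Multiset ℕ) :
    (A.map esymm).prod = esymmProd ((Multiset.toFinsupp A).erase 0) := by
  classical
  have h := Finsupp.mul_prod_erase' (Multiset.toFinsupp A) 0 (fun r k => esymm r ^ k)
    fun _ => pow_zero _
  rw [esymm_zero, one_pow, one_mul] at h
  rw [esymmProd, h, Finset.prod_multiset_map_count, Finsupp.prod, Multiset.toFinsupp_support]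
  rfl

/-! ### Specht spaces -/

/-- `φ` is an equivariant map that identifies the Specht module of `lam` with `U`. -/
structure IsSpechtMap (lam : InfDiagram) (φ : TabloidModule →ₗ[ℚ] PS) (U : Submodule ℚ PS) :
    Prop where
  equivariant : ∀ σ x, φ (tabloidRep σ x) = permRep σ (φ x)
  injOn : ∀ x ∈ spechtModule lam, φ x = 0 → x = 0
  map_eq : (spechtModule lam).map φ = U

theorem isSpechtMap_V (M : InfSSYT lam) : IsSpechtMap lam (toSeries M) (V M) where
  equivariant := toSeries_tabloidRep M
  injOn _ hx h := toSeries_injOn M hx h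
  map_eq := by
    rw [← span_standard_polytabloid, Submodule.map_span, ← Set.range_comp, V]
    congr 2
    funext T
    exact toSeries_polytabloid M T

theorem isSpechtMap_Vh (C : InfSSYT lam) (h : ℕ →₀ ℕ) :
    IsSpechtMap lam (LinearMap.mulRight ℚ (esymmProd h) ∘ₗ toSeries C) (Vh C h) where
  equivariant σ x := by
    change toSeries C (tabloidRep σ x) * esymmProd h = permRep σ (toSeries C x * esymmProd h)
    rw [toSeries_tabloidRep, permRep_mul_apply, permRep_esymmProd]
  injOn x hx h0 :=
    toSeries_injOn C hx ((mul_eq_zero.mp h0).resolve_right (esymmProd_ne_zero h))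
  map_eq := by
    rw [Submodule.map_comp, (isSpechtMap_V C).map_eq, Vh]

theorem IsSpechtSpace.exists_isSpechtMap {U : Submodule ℚ PS} (hU : IsSpechtSpace lam U) :
    ∃ φ, IsSpechtMap lam φ U := by
  rcases hU with ⟨M, rfl⟩ | ⟨C, h, -, rfl⟩
  · exact ⟨_, isSpechtMap_V M⟩
  · exact ⟨_, isSpechtMap_Vh C h⟩

namespace IsSpechtMap

variable {φ φ' : TabloidModule →ₗ[ℚ] PS} {U U' : Submodule ℚ PS}

theorem exists_basis (hφ : IsSpechtMap lam φ U) :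
    ∃ b : Module.Basis (InfSYT lam) ℚ U, ∀ T, (b T : PS) = φ (polytabloid T.box) := by
  have hli : LinearIndependent ℚ (φ ∘ fun T : InfSYT lam => polytabloid T.box) := by
    refine (linearIndependent_polytabloid lam).map ?_
    rw [span_standard_polytabloid, Submodule.disjoint_def]
    exact hφ.injOn
  have hU : U = Submodule.span ℚ (Set.range (φ ∘ fun T : InfSYT lam => polytabloid T.box)) := by
    rw [← hφ.map_eq, ← span_standard_polytabloid, Submodule.map_span, ← Set.range_comp]
  subst hU
  exact ⟨Module.Basis.span hli, fun T => congrArg Subtype.val (Module.Basis.span_apply hli T)⟩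

theorem permRep_mem (hφ : IsSpechtMap lam φ U) (σ : Perm ℕ) {x : PS} (hx : x ∈ U) :
    permRep σ x ∈ U := by
  rw [← hφ.map_eq] at hx ⊢
  obtain ⟨y, hy, rfl⟩ := hx
  exact ⟨tabloidRep σ y, tabloidRep_mem hy σ, hφ.equivariant σ y⟩

/-- The identification of the Specht module with a Specht space. -/
noncomputable def equiv (hφ : IsSpechtMap lam φ U) : spechtModule lam ≃ₗ[ℚ] U :=
  LinearEquiv.ofBijective
    ((φ ∘ₗ (spechtModule lam).subtype).codRestrict U fun x => by
      rw [← hφ.map_eq]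
      exact ⟨x, x.2, rfl⟩)
    ⟨(injective_iff_map_eq_zero _).mpr fun x hx =>
        Subtype.ext (hφ.injOn x x.2 (congrArg Subtype.val hx)),
      fun y => by
        obtain ⟨x, hx, h⟩ := hφ.map_eq.ge y.2
        exact ⟨⟨x, hx⟩, Subtype.ext h⟩⟩

variable {G : Type*} [Group G] {ρ : Representation ℚ G PS} (ι : G → Perm ℕ)
  {W W' : Subrepresentation ρ}

/-- Both groups are treated at once: `ι` is the identity for $S_{\mathbb{N}}$ and the inclusion for
$S_\infty$. -/
theorem equiv_apply (hρ : ∀ g, ρ g = permRep (ι g)) (hφ : IsSpechtMap lam φ W.toSubmodule) (g : G)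
    (x : spechtModule lam) : hφ.equiv ⟨tabloidRep (ι g) x, tabloidRep_mem x.2 (ι g)⟩ =
      W.toRepresentation g (hφ.equiv x) := by
  apply Subtype.ext
  change φ (tabloidRep (ι g) x) = ρ g (φ x)
  rw [hρ, hφ.equivariant]

theorem equiv_symm_apply (hρ : ∀ g, ρ g = permRep (ι g)) (hφ : IsSpechtMap lam φ W.toSubmodule)
    (g : G) (y : W.toSubmodule) : hφ.equiv.symm (W.toRepresentation g y) =
      ⟨tabloidRep (ι g) (hφ.equiv.symm y), tabloidRep_mem (hφ.equiv.symm y).2 (ι g)⟩ := by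
  rw [LinearEquiv.symm_apply_eq, equiv_apply ι hρ, LinearEquiv.apply_symm_apply]

theorem nonempty_equiv (hρ : ∀ g, ρ g = permRep (ι g)) (hφ : IsSpechtMap lam φ W.toSubmodule)
    (hφ' : IsSpechtMap lam φ' W'.toSubmodule) :
    Nonempty (W.toRepresentation.Equiv W'.toRepresentation) := by
  refine ⟨Representation.Equiv.mk (hφ.equiv.symm.trans hφ'.equiv) fun g => ?_⟩
  ext1 y
  change hφ'.equiv (hφ.equiv.symm (W.toRepresentation g y)) =
    W'.toRepresentation g (hφ'.equiv (hφ.equiv.symm y))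
  rw [equiv_symm_apply ι hρ, equiv_apply ι hρ]

theorem isIrreducible (hρ : ∀ g, ρ g = permRep (ι g)) (hι : ∀ σ ∈ finPerm, ∃ g, ι g = σ)
    (hφ : IsSpechtMap lam φ W.toSubmodule) : W.toRepresentation.IsIrreducible where
  exists_pair_ne := by
    obtain ⟨T⟩ := nonempty_tableau lam
    refine ⟨⊥, ⊤, fun h => polytabloid_ne_zero T ?_⟩
    have hmem : hφ.equiv ⟨polytabloid T, polytabloid_mem T⟩ ∈
        (⊥ : Subrepresentation W.toRepresentation).toSubmodule := by
      rw [h]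
      exact Submodule.mem_top
    have h0 : hφ.equiv ⟨polytabloid T, polytabloid_mem T⟩ = 0 := hmem
    exact congrArg Subtype.val ((LinearEquiv.map_eq_zero_iff _).mp h0)
  eq_bot_or_eq_top X := by
    -- `Y` is the subrepresentation `X` pulled back into the Specht module, where the dichotomy for
    -- stable subspaces applies.
    let Y : Submodule ℚ TabloidModule :=
      (X.toSubmodule.comap hφ.equiv.toLinearMap).map (spechtModule lam).subtype
    have hmem : ∀ x : spechtModule lam, (x : TabloidModule) ∈ Y ↔ hφ.equiv x ∈ X.toSubmodule := by
      intro x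
      constructor
      · rintro ⟨y, hy, h⟩
        rwa [← Subtype.ext (a1 := y) (a2 := x) h]
      · intro hx
        exact ⟨x, hx, rfl⟩
    have hle : Y ≤ spechtModule lam := by
      rintro _ ⟨y, -, rfl⟩
      exact y.2
    rcases eq_bot_or_eq_spechtModule hle (fun σ hσ x hx => by
      obtain ⟨g, rfl⟩ := hι σ hσ
      have h := (hmem ⟨x, hle hx⟩).mp hx
      rw [hmem ⟨_, tabloidRep_mem (hle hx) (ι g)⟩, equiv_apply ι hρ hφ g ⟨x, hle hx⟩]
      exact X.apply_mem_toSubmodule g h) with h | h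
    · left
      refine Subrepresentation.toSubmodule_injective ((Submodule.eq_bot_iff _).mpr fun y hy => ?_)
      have hy' : (hφ.equiv.symm y : TabloidModule) ∈ Y := by
        rwa [hmem, LinearEquiv.apply_symm_apply]
      rw [h, Submodule.mem_bot] at hy'
      exact (LinearEquiv.map_eq_zero_iff hφ.equiv.symm).mp (Subtype.ext hy')
    · right
      refine Subrepresentation.toSubmodule_injective (Submodule.eq_top_iff'.mpr fun y => ?_)
      have hy' : (hφ.equiv.symm y : TabloidModule) ∈ Y := by
        rw [h]
        exact (hφ.equiv.symm y).2
      rwa [hmem, LinearEquiv.apply_symm_apply] at hy'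

theorem diagram_eq (hρ : ∀ g, ρ g = permRep (ι g)) (hι : ∀ σ ∈ finPerm, ∃ g, ι g = σ)
    (hφ : IsSpechtMap lam φ W.toSubmodule) (hφ' : IsSpechtMap lam' φ' W'.toSubmodule)
    (f : W.toRepresentation.Equiv W'.toRepresentation) : lam = lam' := by
  refine diagram_eq_of_equiv (hφ.equiv.trans (f.toLinearEquiv.trans hφ'.equiv.symm))
    fun σ hσ x => ?_
  obtain ⟨g, rfl⟩ := hι σ hσ
  have hf : f.toLinearEquiv (W.toRepresentation g (hφ.equiv x)) =
      W'.toRepresentation g (f.toLinearEquiv (hφ.equiv x)) :=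
    LinearMap.congr_fun (f.toIntertwiningMap.isIntertwining' g) (hφ.equiv x)
  rw [LinearEquiv.trans_apply, LinearEquiv.trans_apply, equiv_apply ι hρ, hf,
    equiv_symm_apply ι hρ]
  rfl

end IsSpechtMap

theorem exists_finPerm_coe (σ : Perm ℕ) (hσ : σ ∈ finPerm) : ∃ g : finPerm, (g : Perm ℕ) = σ :=
  ⟨⟨σ, hσ⟩, rfl⟩

theorem FHom_eq (C : InfSSYT lam) (I : Multiset ℕ) (T : InfSYT lam) :
    FHom C I T = F C T * esymmProd (hMultiset C I) := by
  rw [FHom, prod_map_esymm, hMultiset]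

theorem FSet_eq (C : InfSSYT lam) (I : Finset ℕ) (T : InfSYT lam) :
    FSet C I T = F C T * esymmProd (hSet C I) := by
  rw [FSet, hSet, ← prod_map_esymm, Multiset.map_map]
  rfl

theorem exists_basis_Vh (C : InfSSYT lam) (h : ℕ →₀ ℕ) :
    ∃ b : Module.Basis (InfSYT lam) ℚ (Vh C h), ∀ T, (b T : PS) = F C T * esymmProd h := by
  obtain ⟨b, hb⟩ := (isSpechtMap_Vh C h).exists_basis
  refine ⟨b, fun T => (hb T).trans ?_⟩
  rw [← toSeries_polytabloid]
  rfl

end StableSpecht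

/-! ### The five statements, by transport along Specht maps -/

theorem theorem2p13 :
    -- (i) the bases
    (∀ (lam : StableSpecht.InfDiagram) (M : StableSpecht.InfSSYT lam),
      ∃ b : Module.Basis (StableSpecht.InfSYT lam) ℚ (StableSpecht.V M),
        ∀ T, (b T : StableSpecht.PS) = StableSpecht.F M T) ∧
    (∀ (lam : StableSpecht.InfDiagram) (C : StableSpecht.InfSSYT lam), C.IsCocharge →
      (∀ h : ℕ →₀ ℕ, ∃ b : Module.Basis (StableSpecht.InfSYT lam) ℚ (StableSpecht.Vh C h),
        ∀ T, (b T : StableSpecht.PS) = StableSpecht.F C T * StableSpecht.esymmProd h) ∧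
      (∀ I : Finset ℕ, 0 ∉ I → C.dspc ≤ I.val →
        ∃ b : Module.Basis (StableSpecht.InfSYT lam) ℚ
            (StableSpecht.Vh C (StableSpecht.hSet C I)),
          ∀ T, (b T : StableSpecht.PS) = StableSpecht.FSet C I T) ∧
      (∀ I : Multiset ℕ, C.dspc ≤ I →
        ∃ b : Module.Basis (StableSpecht.InfSYT lam) ℚ
            (StableSpecht.Vh C (StableSpecht.hMultiset C I)),
          ∀ T, (b T : StableSpecht.PS) = StableSpecht.FHom C I T)) ∧
    -- (ii) the spaces are representations of both groups
    (∀ (lam : StableSpecht.InfDiagram) (U : Submodule ℚ StableSpecht.PS),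
      StableSpecht.IsSpechtSpace lam U →
        (∃ W : Subrepresentation StableSpecht.permRep, W.toSubmodule = U) ∧
        (∃ W : Subrepresentation StableSpecht.finPermRep, W.toSubmodule = U)) ∧
    -- (iii) the isomorphism type depends only on the diagram
    (∀ lam : StableSpecht.InfDiagram,
      (∀ W W' : Subrepresentation StableSpecht.permRep,
        StableSpecht.IsSpechtSpace lam W.toSubmodule →
        StableSpecht.IsSpechtSpace lam W'.toSubmodule →
          Nonempty (W.toRepresentation.Equiv W'.toRepresentation)) ∧
      (∀ W W' : Subrepresentation StableSpecht.finPermRep,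
        StableSpecht.IsSpechtSpace lam W.toSubmodule →
        StableSpecht.IsSpechtSpace lam W'.toSubmodule →
          Nonempty (W.toRepresentation.Equiv W'.toRepresentation))) ∧
    -- (iv) irreducibility, for either group
    (∀ lam : StableSpecht.InfDiagram,
      (∀ W : Subrepresentation StableSpecht.permRep,
        StableSpecht.IsSpechtSpace lam W.toSubmodule → W.toRepresentation.IsIrreducible) ∧
      (∀ W : Subrepresentation StableSpecht.finPermRep,
        StableSpecht.IsSpechtSpace lam W.toSubmodule → W.toRepresentation.IsIrreducible)) ∧
    -- (v) different diagrams yield non-isomorphic representations, for either group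
    (∀ lam lam' : StableSpecht.InfDiagram, lam ≠ lam' →
      (∀ W W' : Subrepresentation StableSpecht.permRep,
        StableSpecht.IsSpechtSpace lam W.toSubmodule →
        StableSpecht.IsSpechtSpace lam' W'.toSubmodule →
          IsEmpty (W.toRepresentation.Equiv W'.toRepresentation)) ∧
      (∀ W W' : Subrepresentation StableSpecht.finPermRep,
        StableSpecht.IsSpechtSpace lam W.toSubmodule →
        StableSpecht.IsSpechtSpace lam' W'.toSubmodule →
          IsEmpty (W.toRepresentation.Equiv W'.toRepresentation))) := by
  refine ⟨fun lam M => ?_, fun lam C _ => ⟨StableSpecht.exists_basis_Vh C, fun I _ _ => ?_, fun I _ => ?_⟩,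
    fun lam U hU => ?_, fun lam => ⟨fun W W' hW hW' => ?_, fun W W' hW hW' => ?_⟩,
    fun lam => ⟨fun W hW => ?_, fun W hW => ?_⟩,
    fun lam lam' hne => ⟨fun W W' hW hW' => ⟨fun f => hne ?_⟩, fun W W' hW hW' =>
      ⟨fun f => hne ?_⟩⟩⟩
  · obtain ⟨b, hb⟩ := (StableSpecht.isSpechtMap_V M).exists_basis
    exact ⟨b, fun T => (hb T).trans (StableSpecht.toSeries_polytabloid M T)⟩
  · obtain ⟨b, hb⟩ := StableSpecht.exists_basis_Vh C (StableSpecht.hSet C I)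
    exact ⟨b, fun T => (hb T).trans (StableSpecht.FSet_eq C I T).symm⟩
  · obtain ⟨b, hb⟩ := StableSpecht.exists_basis_Vh C (StableSpecht.hMultiset C I)
    exact ⟨b, fun T => (hb T).trans (StableSpecht.FHom_eq C I T).symm⟩
  · obtain ⟨φ, hφ⟩ := hU.exists_isSpechtMap
    exact ⟨⟨⟨U, fun σ _ hx => hφ.permRep_mem σ hx⟩, rfl⟩,
      ⟨⟨U, fun σ _ hx => hφ.permRep_mem σ.1 hx⟩, rfl⟩⟩
  · obtain ⟨φ, hφ⟩ := hW.exists_isSpechtMap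
    obtain ⟨φ', hφ'⟩ := hW'.exists_isSpechtMap
    exact hφ.nonempty_equiv id (fun _ => rfl) hφ'
  · obtain ⟨φ, hφ⟩ := hW.exists_isSpechtMap
    obtain ⟨φ', hφ'⟩ := hW'.exists_isSpechtMap
    exact hφ.nonempty_equiv Subtype.val (fun _ => rfl) hφ'
  · obtain ⟨φ, hφ⟩ := hW.exists_isSpechtMap
    exact hφ.isIrreducible id (fun _ => rfl) fun σ _ => ⟨σ, rfl⟩
  · obtain ⟨φ, hφ⟩ := hW.exists_isSpechtMap
    exact hφ.isIrreducible Subtype.val (fun _ => rfl) StableSpecht.exists_finPerm_coe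
  · obtain ⟨φ, hφ⟩ := hW.exists_isSpechtMap
    obtain ⟨φ', hφ'⟩ := hW'.exists_isSpechtMap
    exact hφ.diagram_eq id (fun _ => rfl) (fun σ _ => ⟨σ, rfl⟩) hφ' f
  · obtain ⟨φ, hφ⟩ := hW.exists_isSpechtMap
    obtain ⟨φ', hφ'⟩ := hW'.exists_isSpechtMap
    exact hφ.diagram_eq Subtype.val (fun _ => rfl) StableSpecht.exists_finPerm_coe hφ' f
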